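/- Setting. The state $\omega\in[0,1]$ is drawn from a prior $\mu_F$ with a strictly positive density $f$. Receiver has $n<\infty$ actions $a_0,\dots,a_{n-1}$; there are cutoffs $0=\gamma_0\le\gamma_1\le\dots\le\gamma_n=1$ such that $a_i$ is optimal for Receiver iff the posterior mean of the state lies in $A_i=[\gamma_i,\gamma_{i+1}]$. Sender's payoff from $a_i$ is $v(a_i)$, with $v(a_0)=0$ and $v(a_k)>v(a_l)$ for $k>l$. Let $\mathcal C$ be the space of nonempty closed subsets of $[0,1]$ with the Hausdorff distance. In state $\omega$ Sender can send exactly the messages $m\in\mathcal C$ with $\omega\in m$. A triple $(\sigma,\tau,p)$ consists of (measurable) maps $\sigma:[0,1]\to\Delta(\mathcal C)$ with $\sigma(\omega)$ concentrated on messages containing $\omega$, $\tau:\mathcal C\to\Delta(\{a_0,\dots,a_{n-1}\})$ and $p:\mathcal C\to\Delta([0,1])$. It is an equilibrium if (1) for every $\omega$, $\sigma(\omega)$ is concentrated on the messages that maximize $v(\tau(m))=\sum_i\tau(a_i\mid m)v(a_i)$ among $m\ni\omega$; (2) for every $m$, $\tau(a_i\mid m)>0$ implies that the mean of $p(m)$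 lies in $A_i$; (3) $p(m)$ is concentrated on $m$ for every $m$; (4) $p$ is obtained from $\mu_F$ and $\sigma$ by Bayes' rule, i.e. it is a conditional distribution of the state given the message. Sender's ex ante payoff is $\int\int v(\tau(m))\,\sigma(dm\mid\omega)\,\mu_F(d\omega)$. A deterministic representation is a family $\{B_i\}_{i=0}^{n-1}$ of (possibly empty) closed subsets of $[0,1]$ with $\bigcup_iB_i=[0,1]$ and $\mu_F(B_i\cap B_j)=0$ for $i\ne j$; it is laminar if $B_i=\mathrm{cl}\big(\mathrm{conv}(B_i)\setminus\bigcup_{k<i}\mathrm{conv}(B_k)\big)$ for every $i$. An equilibrium is an obedient recommendation equilibrium (ORE) with associated deterministic representation $\{B_i\}$ if $\sigma(B_i\mid\omega)=1$ for all $i$ and all $\omega\in B_i\setminus\bigcup_{j>i}B_j$, and $\tau(a_i\mid B_i)=1$ for every $i$ with $B_i\neq\varnothing$. Proposition. All equilibria in which Sender sends $\{\omega\}$ in every state $\omega$ (and such equilibria exist) give Sender the same ex ante payoff $R_U$, the unraveling payoff; and there is a highest ex ante payoff $R_S$ that Sender can attain in an equilibrium, the payoff in her preferred equilibrium. For every $R\in\mathbb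 R$, there is an ORE in which Sender's ex ante payoff is $R$ if and only if $R_U\le R\le R_S$. Moreover, for every $R\in[R_U,R_S]$ there is an ORE whose associated deterministic representation is laminar and in which Sender's ex ante payoff is $R$. -/

import Mathlib

open MeasureTheory ProbabilityTheory Set
open scoped ENNReal

/-- Messages: the nonempty closed (equivalently, nonempty compact) subsets of the state space
`[0,1]`. Mathlib's metric on this type is the Hausdorff distance. -/
abbrev Message : Type := TopologicalSpace.NonemptyCompacts unitInterval

/-- Messages carry the Borel sigma-algebra of the Hausdorff distance. -/
instance instMeasurableSpaceMessage : MeasurableSpace Message := borel Message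

instance instBorelSpaceMessage : BorelSpace Message := ⟨rfl⟩

/-- The primitives of a verifiable disclosure game with state space `[0,1]` and with `n` actions
`a_0, …, a_{n-1}` of Receiver (action `a_i` is `i : Fin n`). -/
structure DisclosureGame (n : ℕ) where
  /-- the density of the common prior -/
  f : unitInterval → ℝ
  measurable_f : Measurable f
  f_pos : ∀ ω, 0 < f ω
  lintegral_f : ∫⁻ ω, ENNReal.ofReal (f ω) = 1
  /-- the cutoffs `γ_0 ≤ γ_1 ≤ ⋯ ≤ γ_n` -/
  γ : Fin (n + 1) → ℝ
  γ_mono : Monotone γ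
  γ_zero : γ 0 = 0
  γ_last : γ (Fin.last n) = 1
  /-- Sender's payoff from Receiver's action -/
  v : Fin n → ℝ
  v_strictMono : StrictMono v
  v_zero : ∀ i : Fin n, (i : ℕ) = 0 → v i = 0

/-- A strategy of Sender, a strategy of Receiver, and a belief system. -/
structure Assessment (n : ℕ) where
  /-- Sender's (mixed) strategy: a distribution over messages in each state -/
  σ : Kernel unitInterval Message
  markov_σ : IsMarkovKernel σ
  /-- only messages that contain the true state may be sent -/
  σ_verifiable : ∀ ω : unitInterval, ∀ᵐ m ∂(σ ω), ω ∈ m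
  /-- Receiver's (mixed) strategy: a distribution over actions after each message -/
  τ : Kernel Message (Fin n)
  markov_τ : IsMarkovKernel τ
  /-- Receiver's belief about the state after each message -/
  p : Kernel Message unitInterval
  markov_p : IsMarkovKernel p

namespace DisclosureGame

variable {n : ℕ} (G : DisclosureGame n)

/-- The prior distribution `μ_F` of the state. -/
noncomputable def prior : Measure unitInterval :=
  volume.withDensity fun ω => ENNReal.ofReal (G.f ω)

/-- `A_i = [γ_i, γ_{i+1}]`, the posterior means at which action `a_i` is optimal for Receiver. -/
def A (i : Fin n) : Set ℝ := Icc (G.γ i.castSucc) (G.γ i.succ)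

/-- `v(τ(m))`: Sender's expected payoff when she sends the message `m`. -/
noncomputable def messagePayoff (e : Assessment n) (m : Message) : ℝ :=
  ∑ i : Fin n, (e.τ m).real {i} * G.v i

/-- Sender's ex ante payoff. -/
noncomputable def payoff (e : Assessment n) : ℝ :=
  ∫ ω, ∫ m, G.messagePayoff e m ∂(e.σ ω) ∂G.prior

/-- Perfect Bayesian equilibrium. -/
structure IsEquilibrium (e : Assessment n) : Prop where
  /-- in every state Sender only uses messages that are optimal among those available there -/
  sender_optimal : ∀ ω : unitInterval, ∀ᵐ m ∂(e.σ ω),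
    ω ∈ m ∧ ∀ m' : Message, ω ∈ m' → G.messagePayoff e m' ≤ G.messagePayoff e m
  /-- after every message Receiver only uses actions that are optimal given the posterior mean -/
  receiver_optimal : ∀ (m : Message) (i : Fin n), 0 < e.τ m {i} →
    ∫ x, (x : ℝ) ∂(e.p m) ∈ G.A i
  /-- states in which the message is not available are deemed impossible -/
  belief_verifiable : ∀ m : Message, ∀ᵐ x ∂(e.p m), x ∈ m
  /-- Bayes' rule: the beliefs are a conditional distribution of the state given the message
  under the joint distribution of state and message -/
  bayes : (e.σ ∘ₘ G.prior) ⊗ₘ e.p = (G.prior ⊗ₘ e.σ).map Prod.swap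

/-- The ex ante payoffs that Sender can attain in an equilibrium. -/
def equilibriumPayoffs : Set ℝ :=
  {R | ∃ e : Assessment n, G.IsEquilibrium e ∧ G.payoff e = R}

/-- Sender's ex ante payoffs in the equilibria that feature unraveling, that is, in which every
state `ω` is fully revealed by the message `{ω}`. -/
def unravelingPayoffs : Set ℝ :=
  {R | ∃ e : Assessment n, G.IsEquilibrium e ∧
    (∀ ω : unitInterval, e.σ ω {({ω} : Message)} = 1) ∧ G.payoff e = R}

/-- Deterministic representations `{B_i}`; some of the `B_i` may be empty. -/
structure IsDeterministicRepresentation (B : Fin n → Set unitInterval) : Prop where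
  isClosed : ∀ i, IsClosed (B i)
  cover : ⋃ i, B i = univ
  null_inter : ∀ i j, i ≠ j → G.prior (B i ∩ B j) = 0

/-- `e` is an obedient recommendation equilibrium with associated deterministic
representation `B`. -/
structure IsORE (e : Assessment n) (B : Fin n → Set unitInterval) : Prop where
  isEquilibrium : G.IsEquilibrium e
  isDeterministicRepresentation : G.IsDeterministicRepresentation B
  /-- the message `B_i` is sent for sure in the states of `B_i` that lie in no `B_j`, `j > i` -/
  send : ∀ i, ∀ ω ∈ B i \ ⋃ j > i, B j, ∃ m : Message, (m : Set unitInterval) = B i ∧ e.σ ω {m} = 1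
  /-- the recommendation is followed (empty `B_i` are not messages) -/
  obey : ∀ i, ∀ m : Message, (m : Set unitInterval) = B i → e.τ m {i} = 1

end DisclosureGame

/-- The convex hull of a set of states, as a subset of `ℝ`. -/
def stateHull (S : Set unitInterval) : Set ℝ := convexHull ℝ ((fun x : unitInterval => (x : ℝ)) '' S)

/-- `B_i = cl (conv B_i \ ⋃_{k < i} conv B_k)` for each `i`: a deterministic representation with
this property is a laminar representation. -/
def IsLaminar {n : ℕ} (B : Fin n → Set unitInterval) : Prop :=
  ∀ i, (fun x : unitInterval => (x : ℝ)) '' B i = closure (stateHull (B i) \ ⋃ k < i, stateHull (B k))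

/-! The problem reduces to a linear one. In an equilibrium, sort the messages by the highest action
that Receiver may take after them, and let `β i x` be the probability that state `x` sends a message
of class `i`. Since `x` can reveal itself, it never joins a class whose action is below the lowest
one optimal at `x`; so class `i` only has states up to `γ_{i+1}`. By Bayes' rule the mean of class
`i` is at least `γ_i`. Sender's payoff is at most the sum of `v i` times the mass of class `i`
(`IsEquilibrium.exists_isFractionalPartition`).

Conversely, only the masses, the first moments and the upper bounds on the cells matter, and
intervals can realize them. Some interval has the same mass and moment as a given fraction of a mass
distribution (`exists_Icc_setIntegral_eq`). When it replaces a cell, the shares that it displaces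
move to what the cell gives up on the two sides, split so that every other cell keeps its mass and
moment (`exists_nonneg_combination`, `exists_Icc_exchange`). Treating the cells in increasing order,
each in the complement of the earlier intervals, gives carved cells (`exists_carvedCell`), whose
closures are laminar. A deterministic representation that meets the constraints supports an ORE,
with skeptical beliefs after all other messages (`IsDeterministicRepresentation.exists_isORE`).

The constraints are convex and the objective is linear, so the payoffs obtained form an interval.
Its maximum exists because the endpoints of carved cells range over a compact set
(`exists_isGreatest`). The unraveling payoff belongs to it, and no equilibrium pays less, because
every state can reveal itself. -/

open Filter Topology

/-! ### Intervals with prescribed mass and first moment -/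

section Analysis

variable {μ : Measure unitInterval}

theorem abs_coe_unitInterval_le_one (x : unitInterval) : |(x : ℝ)| ≤ 1 := by
  rw [abs_of_nonneg x.2.1]; exact x.2.2

theorem MeasureTheory.Integrable.coe_mul {h : unitInterval → ℝ} (hh : Integrable h μ) :
    Integrable (fun x : unitInterval => (x : ℝ) * h x) μ :=
  hh.bdd_mul (c := 1) (measurable_subtype_coe.aestronglyMeasurable)
    (ae_of_all _ fun x : unitInterval => by simpa using abs_coe_unitInterval_le_one x)

/-- The integral over a set that depends on a parameter is continuous in the parameter if almost
no point changes membership in the limit. -/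
theorem continuous_setIntegral_of_ae_eventually {X : Type*} [TopologicalSpace X]
    [FirstCountableTopology X] {E : X → Set unitInterval} (hE : ∀ t, MeasurableSet (E t))
    (hlim : ∀ t, ∀ᵐ x ∂μ, ∀ᶠ s in 𝓝 t, (x ∈ E s ↔ x ∈ E t))
    {h : unitInterval → ℝ} (hh : Integrable h μ) :
    Continuous fun t => ∫ x in E t, h x ∂μ := by
  simp_rw [← fun t => integral_indicator (f := h) (μ := μ) (hE t)]
  refine continuous_iff_continuousAt.2 fun t => ?_
  refine continuousAt_of_dominated (bound := fun x => ‖h x‖)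
    (Eventually.of_forall fun s => (hh.indicator (hE s)).aestronglyMeasurable)
    (Eventually.of_forall fun s => ae_of_all _ fun x => norm_indicator_le_norm_self _ _)
    hh.norm ?_
  filter_upwards [hlim t] with x hx
  refine (continuousAt_const (y := (E t).indicator h x)).congr ?_
  filter_upwards [hx] with s hs
  by_cases hm : x ∈ E t
  · simp [hm, hs.2 hm]
  · have : x ∉ E s := fun h => hm (hs.1 h)
    simp [hm, this]

theorem eventually_le_iff_of_ne {α : Type*} [LinearOrder α] [TopologicalSpace α]
    [OrderTopology α] {x t : α} (hx : x ≠ t) : ∀ᶠ s in 𝓝 t, (x ≤ s ↔ x ≤ t) := by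
  rcases lt_or_gt_of_ne hx with h | h
  · filter_upwards [lt_mem_nhds h] with s hs
    exact ⟨fun _ => h.le, fun _ => hs.le⟩
  · filter_upwards [gt_mem_nhds h] with s hs
    exact ⟨fun h' => absurd hs h'.not_gt, fun h' => absurd h h'.not_gt⟩

theorem eventually_ge_iff_of_ne {α : Type*} [LinearOrder α] [TopologicalSpace α]
    [OrderTopology α] {x t : α} (hx : x ≠ t) : ∀ᶠ s in 𝓝 t, (s ≤ x ↔ t ≤ x) := by
  rcases lt_or_gt_of_ne hx with h | h
  · filter_upwards [lt_mem_nhds h] with s hs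
    exact ⟨fun h' => absurd hs h'.not_gt, fun h' => absurd h h'.not_gt⟩
  · filter_upwards [gt_mem_nhds h] with s hs
    exact ⟨fun _ => h.le, fun _ => hs.le⟩

theorem continuous_setIntegral_Iic [NullSingletonClass μ] {h : unitInterval → ℝ} (hh : Integrable h μ) :
    Continuous fun t => ∫ x in Iic t, h x ∂μ := by
  refine continuous_setIntegral_of_ae_eventually (fun t => measurableSet_Iic) (fun t => ?_) hh
  have : ∀ᵐ x ∂μ, x ≠ t := by simp [ae_iff]
  filter_upwards [this] with x hx using eventually_le_iff_of_ne hx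

theorem setIntegral_Icc_eq_sub [NullSingletonClass μ] {h : unitInterval → ℝ} (hh : Integrable h μ)
    {a b : unitInterval} (hab : a ≤ b) :
    ∫ x in Icc a b, h x ∂μ = ∫ x in Iic b, h x ∂μ - ∫ x in Iic a, h x ∂μ := by
  rw [integral_Icc_eq_integral_Ioc, ← Iic_sdiff_Iic,
    setIntegral_sdiff measurableSet_Iic hh.integrableOn (Iic_subset_Iic.2 hab)]

/-- A fraction `β` of an atomless mass distribution `w` can be replaced by an interval with the
same mass and the same first moment. -/
theorem exists_Icc_setIntegral_eq [NullSingletonClass μ] {w β : unitInterval → ℝ}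
    (hw : Integrable w μ) (hβ : Integrable β μ) (h0 : 0 ≤ᵐ[μ] β) (hle : β ≤ᵐ[μ] w) :
    ∃ a b : unitInterval, ∫ x in Icc a b, w x ∂μ = ∫ x, β x ∂μ ∧
      ∫ x in Icc a b, (x : ℝ) * w x ∂μ = ∫ x, (x : ℝ) * β x ∂μ := by
  have hw0 : 0 ≤ᵐ[μ] w := h0.trans hle
  set g : unitInterval → ℝ := fun t => ∫ x in Iic t, w x ∂μ with hg
  set P : unitInterval → ℝ := fun t => ∫ x in Iic t, (x : ℝ) * w x ∂μ with hP
  have hgc : Continuous g := continuous_setIntegral_Iic hw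
  have hPc : Continuous P := continuous_setIntegral_Iic hw.coe_mul
  have hg1 : g 1 = ∫ x, w x ∂μ := by
    have : Iic (1 : unitInterval) = univ := eq_univ_of_forall fun x => x.2.2
    simp [hg, this]
  have hg0 : g 0 = 0 := by
    have : Iic (0 : unitInterval) = {0} := by
      ext x; simp only [mem_Iic, mem_singleton_iff]
      exact ⟨fun h => le_antisymm h x.2.1, fun h => h.le⟩
    simp [hg, this]
  have hgm : Monotone g := fun s t hst => by
    have := setIntegral_Icc_eq_sub hw hst
    have h2 : 0 ≤ ∫ x in Icc s t, w x ∂μ := integral_nonneg_of_ae (ae_restrict_of_ae hw0)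
    simp only [hg]; linarith
  have hPg1 : ∀ s t, s ≤ t → 0 ≤ P t - P s ∧ P t - P s ≤ g t - g s := fun s t hst => by
    simp only [hg, hP]
    rw [← setIntegral_Icc_eq_sub hw hst, ← setIntegral_Icc_eq_sub hw.coe_mul hst]
    constructor
    · refine integral_nonneg_of_ae (ae_restrict_of_ae ?_)
      filter_upwards [hw0] with x hx using mul_nonneg x.2.1 hx
    · refine integral_mono_ae hw.coe_mul.integrableOn hw.integrableOn (ae_restrict_of_ae ?_)
      filter_upwards [hw0] with x hx
      exact mul_le_of_le_one_left hx x.2.2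
  have hPg : ∀ s t, |P t - P s| ≤ |g t - g s| := fun s t => by
    rcases le_total s t with h | h
    · have := hPg1 s t h
      rw [abs_of_nonneg this.1, abs_of_nonneg (this.1.trans this.2)]; exact this.2
    · have := hPg1 t s h
      rw [abs_sub_comm, abs_sub_comm (g t), abs_of_nonneg this.1,
        abs_of_nonneg (this.1.trans this.2)]; exact this.2
  set q := ∫ x, β x ∂μ with hq
  set m := ∫ x, (x : ℝ) * β x ∂μ with hm
  have hq0 : 0 ≤ q := integral_nonneg_of_ae h0
  have hqW : q ≤ g 1 := by rw [hg1]; exact integral_mono_ae hβ hw hle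
  have ivt : ∀ y, 0 ≤ y → y ≤ g 1 → ∃ b, g b = y := fun y h1 h2 =>
    mem_range_of_exists_le_of_exists_ge hgc ⟨0, by rw [hg0]; exact h1⟩ ⟨1, h2⟩
  -- `A` is a last starting point that leaves mass `q` to its right. Windows of mass `q` start at
  -- `min a A`, so that every `a` is admissible.
  obtain ⟨A, hA⟩ := ivt (g 1 - q) (by linarith) (by linarith)
  have hb : ∀ a, ∃ b, min a A ≤ b ∧ g b = g (min a A) + q := fun a => by
    have h1 : g (min a A) + q ≤ g 1 := by
      have := hgm (min_le_right a A); linarith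
    have h2 : 0 ≤ g (min a A) := by rw [← hg0]; exact hgm (unitInterval.nonneg' )
    obtain ⟨b, hb⟩ := ivt _ (add_nonneg h2 hq0) h1
    -- The point `b` may lie left of the start only if `q = 0`; the start itself then serves as the
    -- end.
    refine ⟨max b (min a A), le_max_right _ _, ?_⟩
    rcases le_total b (min a A) with h | h
    · rw [max_eq_right h]
      have := hgm h
      linarith
    · rw [max_eq_left h, hb]
  choose b hab hgb using hb
  set M : unitInterval → ℝ := fun a => P (b a) - P (min a A) with hM
  have hMc : Continuous M := by
    -- The choice `b` need not be continuous where `w` has gaps. Its moment is, since increments of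
    -- `P` are bounded by those of `g`, and `g (b a)` is continuous in `a`.
    have hPb : Continuous fun a => P (b a) := by
      refine continuous_iff_continuousAt.2 fun a => ?_
      have hlim : Tendsto (fun s => |g (min s A) - g (min a A)|) (𝓝 a) (𝓝 0) := by
        have hc : Continuous fun s => |g (min s A) - g (min a A)| := by fun_prop
        have := hc.tendsto a
        simpa using this
      rw [ContinuousAt, tendsto_iff_dist_tendsto_zero]
      refine squeeze_zero (fun _ => dist_nonneg) (fun s => ?_) hlim
      rw [Real.dist_eq]
      refine (hPg _ _).trans (le_of_eq ?_)
      rw [hgb, hgb]; congr 1; ring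
    have : Continuous fun a => P (min a A) := by fun_prop
    exact hPb.sub this
  have hint : ∀ t : unitInterval, ∀ E : Set unitInterval, MeasurableSet E →
      Integrable (fun x : unitInterval => ((x : ℝ) - t) * (β x - E.indicator w x)) μ := fun t E hE => by
    have h1 : Integrable (fun x => β x - E.indicator w x) μ := hβ.sub (hw.indicator hE)
    have := h1.coe_mul.sub (h1.const_mul (t : ℝ))
    refine this.congr (ae_of_all _ fun x => ?_)
    simp; ring
  have hcalc : ∀ t : unitInterval, ∀ E : Set unitInterval, MeasurableSet E →
      ∫ x : unitInterval, ((x : ℝ) - t) * (β x - E.indicator w x) ∂μ =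
        (m - ∫ x in E, (x : ℝ) * w x ∂μ) - t * (q - ∫ x in E, w x ∂μ) := fun t E hE => by
    rw [hm, hq, ← integral_indicator hE, ← integral_indicator hE,
      ← integral_sub hβ.coe_mul (hw.coe_mul.indicator hE), ← integral_sub hβ (hw.indicator hE),
      ← integral_const_mul, ← integral_sub]
    · congr 1; ext x
      by_cases hx : x ∈ E <;> simp [hx] <;> ring
    · exact hβ.coe_mul.sub (hw.coe_mul.indicator hE)
    · exact (hβ.sub (hw.indicator hE)).const_mul _
  have hlow : M 0 ≤ m := by
    have h00 : min (0 : unitInterval) A = 0 := min_eq_left unitInterval.nonneg'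
    have e1 : M 0 = ∫ x in Icc 0 (b 0), (x : ℝ) * w x ∂μ := by
      rw [setIntegral_Icc_eq_sub hw.coe_mul unitInterval.nonneg', hM]; simp only [hP, h00]
    have e2 : ∫ x in Icc 0 (b 0), w x ∂μ = q := by
      rw [setIntegral_Icc_eq_sub hw unitInterval.nonneg']
      have := hgb 0
      rw [h00] at this
      simp only [hg] at this; linarith
    have h3 := hcalc (b 0) (Icc 0 (b 0)) measurableSet_Icc
    rw [e2, ← e1] at h3
    -- Bathtub principle: up to `b 0` the window has all of `w`, beyond it nothing, so both factors
    -- change sign there. Equal masses cancel the term in `b 0`. The rightmost window is treated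
    -- symmetrically below.
    have h4 : 0 ≤ ∫ x : unitInterval, ((x : ℝ) - b 0) * (β x - (Icc 0 (b 0)).indicator w x) ∂μ := by
      refine integral_nonneg_of_ae ?_
      filter_upwards [h0, hle] with x hx hx'
      simp only [Pi.zero_apply] at hx ⊢
      by_cases h : x ≤ b 0
      · have hmem : x ∈ Icc 0 (b 0) := ⟨unitInterval.nonneg', h⟩
        rw [indicator_of_mem hmem]
        have : (x : ℝ) ≤ b 0 := h
        exact mul_nonneg_of_nonpos_of_nonpos (by linarith) (by linarith)
      · have hmem : x ∉ Icc 0 (b 0) := fun h' => h h'.2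
        rw [indicator_of_notMem hmem]
        have : (b 0 : ℝ) < x := not_le.1 h
        exact mul_nonneg (by linarith) (by linarith)
    linarith
  have hhigh : m ≤ M 1 := by
    have h11 : min (1 : unitInterval) A = A := min_eq_right unitInterval.le_one'
    have hb1 : g (b 1) = g 1 := by rw [hgb, h11, hA]; ring
    have hPb1 : P (b 1) = P 1 := by
      have := hPg 1 (b 1)
      rw [hb1, sub_self, abs_zero] at this
      linarith [abs_nonpos_iff.1 this]
    have e1 : M 1 = ∫ x in Icc A 1, (x : ℝ) * w x ∂μ := by
      rw [setIntegral_Icc_eq_sub hw.coe_mul unitInterval.le_one', hM]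
      simp only [h11, hPb1]; rfl
    have e2 : ∫ x in Icc A 1, w x ∂μ = q := by
      rw [setIntegral_Icc_eq_sub hw unitInterval.le_one']
      simp only [hg] at hA ⊢; linarith
    have h3 := hcalc A (Icc A 1) measurableSet_Icc
    rw [e2, ← e1] at h3
    have h4 : ∫ x : unitInterval, ((x : ℝ) - A) * (β x - (Icc A 1).indicator w x) ∂μ ≤ 0 := by
      refine integral_nonpos_of_ae ?_
      filter_upwards [h0, hle] with x hx hx'
      simp only [Pi.zero_apply] at hx ⊢
      by_cases h : A ≤ x
      · have hmem : x ∈ Icc A 1 := ⟨h, unitInterval.le_one'⟩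
        rw [indicator_of_mem hmem]
        have : (A : ℝ) ≤ x := h
        exact mul_nonpos_of_nonneg_of_nonpos (by linarith) (by linarith)
      · have hmem : x ∉ Icc A 1 := fun h' => h h'.1
        rw [indicator_of_notMem hmem]
        have : (x : ℝ) < A := not_le.1 h
        exact mul_nonpos_of_nonpos_of_nonneg (by linarith) (by linarith)
    linarith
  obtain ⟨a, ha⟩ := mem_range_of_exists_le_of_exists_ge hMc ⟨0, hlow⟩ ⟨1, hhigh⟩
  refine ⟨min a A, b a, ?_, ?_⟩
  · rw [setIntegral_Icc_eq_sub hw (hab a)]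
    have := hgb a
    simp only [hg] at this; linarith
  · rw [setIntegral_Icc_eq_sub hw.coe_mul (hab a)]
    exact ha

end Analysis

/-! ### Exchange between the cells of a fractional partition -/

theorem integral_add_add {α : Type*} [MeasurableSpace α] {μ : Measure α} {f g h : α → ℝ}
    (hf : Integrable f μ) (hg : Integrable g μ) (hh : Integrable h μ) :
    ∫ x, f x + g x + h x ∂μ = ∫ x, f x ∂μ + ∫ x, g x ∂μ + ∫ x, h x ∂μ := by
  have h1 := integral_add (hf.add hg) hh
  have h2 := integral_add hf hg
  simp only [Pi.add_apply] at h1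
  rw [h1, h2]

/-- Barycentric coordinates: points `(c i, d i)` of the plane whose slopes lie in `[a, b]` are
nonnegative combinations of a vector of slope below `a` and one of slope above `b`. -/
theorem exists_nonneg_combination {ι : Type*} (s : Finset ι) {c d : ι → ℝ}
    {L0 L1 R0 R1 a b : ℝ} (hab : a ≤ b) (hL0 : 0 ≤ L0) (hL : 0 < L0 → L1 < a * L0)
    (hR0 : 0 ≤ R0) (hR : 0 < R0 → b * R0 < R1) (hL1 : L0 = 0 → L1 = 0) (hR1 : R0 = 0 → R1 = 0)
    (hc : ∀ i ∈ s, 0 ≤ c i) (hda : ∀ i ∈ s, a * c i ≤ d i) (hdb : ∀ i ∈ s, d i ≤ b * c i)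
    (hcs : ∑ i ∈ s, c i = L0 + R0) (hds : ∑ i ∈ s, d i = L1 + R1) :
    ∃ l r : ι → ℝ, (∀ i ∈ s, 0 ≤ l i) ∧ (∀ i ∈ s, 0 ≤ r i) ∧
      (∀ i ∈ s, l i * L0 + r i * R0 = c i) ∧ (∀ i ∈ s, l i * L1 + r i * R1 = d i) ∧
      ((L0 = 0 ∧ R0 = 0) ∨ (∑ i ∈ s, l i = 1 ∧ ∑ i ∈ s, r i = 1)) ∧
      ∀ i ∈ s, c i = 0 → d i = 0 → l i = 0 ∧ r i = 0 := by
  have hlow : a * (L0 + R0) ≤ L1 + R1 := by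
    rw [← hcs, ← hds, Finset.mul_sum]; exact Finset.sum_le_sum hda
  have hupp : L1 + R1 ≤ b * (L0 + R0) := by
    rw [← hcs, ← hds, Finset.mul_sum]; exact Finset.sum_le_sum hdb
  rcases hL0.eq_or_lt with h | hLp
  -- If only one of the two vectors were nonzero, the total would have a slope outside `[a, b]`,
  -- although it is a sum of points with slopes inside.
  · have hR00 : R0 = 0 := by
      by_contra hne
      have hp : 0 < R0 := lt_of_le_of_ne hR0 (Ne.symm hne)
      have := hR hp
      rw [← h, hL1 h.symm] at hupp
      linarith
    have hc0 : ∀ i ∈ s, c i = 0 := by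
      rw [← Finset.sum_eq_zero_iff_of_nonneg hc, hcs, hR00, ← h, add_zero]
    have hd0 : ∀ i ∈ s, d i = 0 := fun i hi => by
      have h1 := hda i hi
      have h2 := hdb i hi
      rw [hc0 i hi] at h1 h2
      linarith
    refine ⟨0, 0, by simp, by simp, ?_, ?_, Or.inl ⟨h.symm, hR00⟩, by simp⟩
    · intro i hi; simp [hc0 i hi]
    · intro i hi; simp [hd0 i hi]
  · have hRp : 0 < R0 := by
      rcases hR0.eq_or_lt with h | h
      · have := hL hLp
        rw [← h, hR1 h.symm] at hlow
        linarith
      · exact h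
    have h1 := hL hLp
    have h2 := hR hRp
    have hdet : 0 < L0 * R1 - L1 * R0 := by
      have e1 : L0 * (b * R0) < L0 * R1 := mul_lt_mul_of_pos_left h2 hLp
      have e2 : L1 * R0 < a * L0 * R0 := mul_lt_mul_of_pos_right h1 hRp
      have e3 : a * (L0 * R0) ≤ b * (L0 * R0) :=
        mul_le_mul_of_nonneg_right hab (mul_nonneg hL0 hR0)
      nlinarith
    -- Cramer's rule for the basis `(L0, L1)`, `(R0, R1)`. The slope bounds make the determinant
    -- positive and the numerators nonnegative; the sums are one because the points add up to the
    -- sum of the basis vectors.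
    refine ⟨fun i => (c i * R1 - d i * R0) / (L0 * R1 - L1 * R0),
      fun i => (d i * L0 - c i * L1) / (L0 * R1 - L1 * R0), ?_, ?_, ?_, ?_, Or.inr ⟨?_, ?_⟩, ?_⟩
    · intro i hi
      refine div_nonneg ?_ hdet.le
      have e1 := mul_le_mul_of_nonneg_right (hdb i hi) hR0
      have e2 := mul_le_mul_of_nonneg_left h2.le (hc i hi)
      nlinarith
    · intro i hi
      refine div_nonneg ?_ hdet.le
      have e1 := mul_le_mul_of_nonneg_right (hda i hi) hL0
      have e2 := mul_le_mul_of_nonneg_left h1.le (hc i hi)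
      nlinarith
    · intro i hi
      rw [div_mul_eq_mul_div, div_mul_eq_mul_div, ← add_div, div_eq_iff hdet.ne']
      ring
    · intro i hi
      rw [div_mul_eq_mul_div, div_mul_eq_mul_div, ← add_div, div_eq_iff hdet.ne']
      ring
    · rw [← Finset.sum_div, Finset.sum_sub_distrib, ← Finset.sum_mul, ← Finset.sum_mul, hcs, hds,
        div_eq_one_iff_eq hdet.ne']
      ring
    · rw [← Finset.sum_div, Finset.sum_sub_distrib, ← Finset.sum_mul, ← Finset.sum_mul, hcs, hds,
        div_eq_one_iff_eq hdet.ne']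
      ring
    · intro i _ h1 h2; simp [h1, h2]

/-- A fractional partition: `β i x` is the share of the state `x` that goes to cell `i`, and cell
`i` only gets states up to `c i`. -/
structure IsFractionalPartition {n : ℕ} (μ : Measure unitInterval) (c : Fin n → unitInterval)
    (β : Fin n → unitInterval → ℝ) : Prop where
  measurable : ∀ i, Measurable (β i)
  nonneg : ∀ i x, 0 ≤ β i x
  sum_eq_one : ∀ᵐ x ∂μ, ∑ i, β i x = 1
  support : ∀ i, ∀ᵐ x ∂μ, c i < x → β i x = 0

namespace IsFractionalPartition

variable {n : ℕ} {μ : Measure unitInterval} {c : Fin n → unitInterval}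
  {β : Fin n → unitInterval → ℝ}

theorem ae_le_one (h : IsFractionalPartition μ c β) (i : Fin n) : ∀ᵐ x ∂μ, β i x ≤ 1 := by
  filter_upwards [h.sum_eq_one] with x hx
  rw [← hx]
  exact Finset.single_le_sum (f := fun i => β i x) (fun j _ => h.nonneg j x) (Finset.mem_univ i)

theorem integrable [IsFiniteMeasure μ] (h : IsFractionalPartition μ c β) (i : Fin n) :
    Integrable (β i) μ := by
  refine Integrable.of_bound (C := 1) (h.measurable i).aestronglyMeasurable ?_
  filter_upwards [h.ae_le_one i] with x hx
  rwa [Real.norm_of_nonneg (h.nonneg i x)]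

/-- One cell of a fractional partition can be made an interval (within a set `D` that the lower
cells do not meet) without changing the masses and the first moments of the cells. -/
theorem exists_Icc_exchange [IsFiniteMeasure μ] [NullSingletonClass μ]
    (h : IsFractionalPartition μ c β) (hc : Monotone c) (k : Fin n) {D : Set unitInterval}
    (hD : MeasurableSet D) (hlt : ∀ i < k, ∀ᵐ x ∂μ, x ∈ D → β i x = 0)
    (hk : ∀ᵐ x ∂μ, x ∉ D → β k x = 0) :
    ∃ (a b : unitInterval) (β' : Fin n → unitInterval → ℝ), IsFractionalPartition μ c β' ∧
      (∀ i, ∫ x, β' i x ∂μ = ∫ x, β i x ∂μ) ∧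
      (∀ i, ∫ x, (x : ℝ) * β' i x ∂μ = ∫ x, (x : ℝ) * β i x ∂μ) ∧
      (∀ i < k, β' i =ᵐ[μ] β i) ∧ β' k =ᵐ[μ] (Icc a b ∩ D).indicator 1 ∧ b ≤ c k ∧
      (∫ x, β k x ∂μ = 0 → b < a) := by
  by_cases hq : ∫ x, β k x ∂μ = 0
  -- A null cell gets the empty interval `Icc 1 0`, not a degenerate one: a nonempty null set could
  -- not serve as a message with a conditional belief.
  · refine ⟨1, 0, β, h, fun _ => rfl, fun _ => rfl, fun _ _ => ae_eq_rfl, ?_,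
      unitInterval.nonneg', fun _ => by simp⟩
    have : Icc (1 : unitInterval) 0 = ∅ := Icc_eq_empty (by simp)
    rw [this, empty_inter, indicator_empty]
    exact (integral_eq_zero_iff_of_nonneg (h.nonneg k) (h.integrable k)).1 hq
  obtain ⟨a, b₀, hm0, hm1⟩ := exists_Icc_setIntegral_eq (μ := μ)
    (w := (D ∩ Iic (c k)).indicator 1) (β := β k)
    ((integrable_const (1 : ℝ)).indicator (hD.inter measurableSet_Iic)) (h.integrable k)
    (ae_of_all _ (h.nonneg k)) (by
      filter_upwards [h.ae_le_one k, hk, h.support k] with x h1 h2 h3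
      by_cases hx : x ∈ D ∩ Iic (c k)
      · simpa [hx] using h1
      · rw [indicator_of_notMem hx]
        by_cases hxD : x ∈ D
        · exact (h3 (not_le.1 fun h' => hx ⟨hxD, h'⟩)).le
        · exact (h2 hxD).le)
  -- Cutting at `c k` leaves the window's mass unchanged, since the weight vanishes beyond it.
  set b := min b₀ (c k) with hb
  set E := Icc a b ∩ D with hE
  have hEm : MeasurableSet E := measurableSet_Icc.inter hD
  have hEeq : Icc a b₀ ∩ (D ∩ Iic (c k)) = E := by
    ext x; simp only [hE, hb, mem_inter_iff, mem_Icc, mem_Iic, le_min_iff]; tauto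
  have hE0 : ∫ x in E, (1 : ℝ) ∂μ = ∫ x, β k x ∂μ := by
    rw [← hm0, setIntegral_indicator (hD.inter measurableSet_Iic), hEeq]; rfl
  have hE1 : ∫ x in E, (x : ℝ) ∂μ = ∫ x, (x : ℝ) * β k x ∂μ := by
    rw [← hm1, ← hEeq, ← setIntegral_indicator (hD.inter measurableSet_Iic)]
    congr 1; ext x
    by_cases hx : x ∈ D ∩ Iic (c k) <;> simp [hx]
  have hab : a ≤ b := by
    by_contra hlt
    have : E = ∅ := by rw [hE, Icc_eq_empty hlt, empty_inter]
    rw [this] at hE0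
    simp at hE0
    exact hq hE0.symm
  -- `L` and `R` are the shares that cell `k` gives up left and right of the interval. In mass and
  -- in first moment they balance exactly the shares that the other cells lose on `E` (`hcs`,
  -- `hds`).
  set L := (Iio a).indicator (β k) with hLdef
  set R := (Ioi b).indicator (β k) with hRdef
  have hLi : Integrable L μ := (h.integrable k).indicator measurableSet_Iio
  have hRi : Integrable R μ := (h.integrable k).indicator measurableSet_Ioi
  have hLn : ∀ x, 0 ≤ L x := fun x => indicator_nonneg (fun x _ => h.nonneg k x) x
  have hRn : ∀ x, 0 ≤ R x := fun x => indicator_nonneg (fun x _ => h.nonneg k x) x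
  have hsplit : ∀ᵐ x ∂μ, β k x = E.indicator (β k) x + L x + R x := by
    filter_upwards [hk] with x hx
    by_cases hxD : x ∈ D
    · by_cases h1 : x < a
      · have h2 : x ∉ E := fun h' => h'.1.1.not_gt h1
        have h3 : ¬ b < x := fun h' => (hab.trans h'.le).not_gt h1
        simp [hLdef, hRdef, h1, h2, h3]
      · by_cases h3 : b < x
        · have h2 : x ∉ E := fun h' => h'.1.2.not_gt h3
          simp [hLdef, hRdef, h1, h2, h3]
        · have h2 : x ∈ E := ⟨⟨not_lt.1 h1, not_lt.1 h3⟩, hxD⟩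
          simp [hLdef, hRdef, h1, h2, h3]
    · have h2 : x ∉ E := fun h' => hxD h'.2
      simp [hLdef, hRdef, indicator_apply, hx hxD, h2]
  have hint : ∀ i, Integrable (β i) μ := h.integrable
  have hL : 0 < ∫ x, L x ∂μ → ∫ x, (x : ℝ) * L x ∂μ < a * ∫ x, L x ∂μ := by
    intro hpos
    have hi : Integrable (fun x : unitInterval => ((a : ℝ) - x) * L x) μ := by
      refine ((hLi.const_mul (a : ℝ)).sub hLi.coe_mul).congr (ae_of_all _ fun x => ?_)
      simp; ring
    have hn : ∀ x : unitInterval, 0 ≤ ((a : ℝ) - x) * L x := fun x => by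
      by_cases hx : x < a
      · exact mul_nonneg (sub_nonneg.2 (le_of_lt hx)) (hLn x)
      · simp [hLdef, hx]
    have he : ∫ x : unitInterval, ((a : ℝ) - x) * L x ∂μ =
        a * ∫ x, L x ∂μ - ∫ x, (x : ℝ) * L x ∂μ := by
      rw [← integral_const_mul, ← integral_sub (hLi.const_mul (a : ℝ)) hLi.coe_mul]
      congr 1; ext x; ring
    have h0 := integral_nonneg (μ := μ) (Pi.le_def.2 hn)
    refine lt_of_le_of_ne (by linarith) fun heq => ?_
    rw [heq, sub_self, integral_eq_zero_iff_of_nonneg hn hi] at he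
    have : L =ᵐ[μ] 0 := by
      filter_upwards [he] with x hx
      by_cases hxa : x < a
      · exact (mul_eq_zero.1 hx).resolve_left (sub_pos.2 (Subtype.coe_lt_coe.2 hxa)).ne'
      · simp [hLdef, hxa]
    rw [integral_congr_ae this] at hpos
    simp at hpos
  have hR : 0 < ∫ x, R x ∂μ → b * ∫ x, R x ∂μ < ∫ x, (x : ℝ) * R x ∂μ := by
    intro hpos
    have hi : Integrable (fun x : unitInterval => ((x : ℝ) - b) * R x) μ := by
      refine (hRi.coe_mul.sub (hRi.const_mul (b : ℝ))).congr (ae_of_all _ fun x => ?_)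
      simp; ring
    have hn : ∀ x : unitInterval, 0 ≤ ((x : ℝ) - b) * R x := fun x => by
      by_cases hx : b < x
      · exact mul_nonneg (sub_nonneg.2 (le_of_lt hx)) (hRn x)
      · simp [hRdef, hx]
    have he : ∫ x : unitInterval, ((x : ℝ) - b) * R x ∂μ =
        ∫ x, (x : ℝ) * R x ∂μ - b * ∫ x, R x ∂μ := by
      rw [← integral_const_mul, ← integral_sub hRi.coe_mul (hRi.const_mul (b : ℝ))]
      congr 1; ext x; ring
    have h0 := integral_nonneg (μ := μ) (Pi.le_def.2 hn)
    refine lt_of_le_of_ne (by linarith) fun heq => ?_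
    rw [heq, sub_self, integral_eq_zero_iff_of_nonneg hn hi] at he
    have : R =ᵐ[μ] 0 := by
      filter_upwards [he] with x hx
      by_cases hxa : b < x
      · exact (mul_eq_zero.1 hx).resolve_left (sub_pos.2 (Subtype.coe_lt_coe.2 hxa)).ne'
      · simp [hRdef, hxa]
    rw [integral_congr_ae this] at hpos
    simp at hpos
  have hL1 : ∫ x, L x ∂μ = 0 → ∫ x, (x : ℝ) * L x ∂μ = 0 := fun h0 => by
    have := (integral_eq_zero_iff_of_nonneg hLn hLi).1 h0
    refine integral_eq_zero_of_ae ?_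
    filter_upwards [this] with x hx
    simp only [hx, Pi.zero_apply, mul_zero]
  have hR1 : ∫ x, R x ∂μ = 0 → ∫ x, (x : ℝ) * R x ∂μ = 0 := fun h0 => by
    have := (integral_eq_zero_iff_of_nonneg hRn hRi).1 h0
    refine integral_eq_zero_of_ae ?_
    filter_upwards [this] with x hx
    simp only [hx, Pi.zero_apply, mul_zero]
  have hsum : ∀ᵐ x ∂μ, ∑ i ∈ Finset.univ.erase k, β i x = 1 - β k x := by
    filter_upwards [h.sum_eq_one] with x hx
    rw [← hx, ← Finset.add_sum_erase _ _ (Finset.mem_univ k)]; ring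
  have hcs : ∑ i ∈ Finset.univ.erase k, ∫ x in E, β i x ∂μ = ∫ x, L x ∂μ + ∫ x, R x ∂μ := by
    rw [← integral_finsetSum _ fun i _ => (hint i).integrableOn,
      integral_congr_ae (ae_restrict_of_ae hsum), integral_sub
        (integrable_const (1 : ℝ)).integrableOn (hint k).integrableOn, hE0,
      integral_congr_ae hsplit, integral_add_add ((hint k).indicator hEm) hLi hRi,
      integral_indicator hEm]
    ring
  have hds : ∑ i ∈ Finset.univ.erase k, ∫ x in E, (x : ℝ) * β i x ∂μ =
      ∫ x, (x : ℝ) * L x ∂μ + ∫ x, (x : ℝ) * R x ∂μ := by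
    have e1 : ∀ᵐ x : unitInterval ∂μ, ∑ i ∈ Finset.univ.erase k, (x : ℝ) * β i x = x - (x : ℝ) * β k x := by
      filter_upwards [hsum] with x hx
      rw [← Finset.mul_sum, hx]; ring
    have e2 : ∀ᵐ x : unitInterval ∂μ, (x : ℝ) * β k x =
        E.indicator (fun x => (x : ℝ) * β k x) x + (x : ℝ) * L x + (x : ℝ) * R x := by
      filter_upwards [hsplit] with x hx
      conv_lhs => rw [hx]
      by_cases hxE : x ∈ E <;> simp [hxE] <;> ring
    have hx1 : Integrable (fun x : unitInterval => (x : ℝ)) μ := by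
      simpa using (integrable_const (1 : ℝ)).coe_mul (μ := μ)
    rw [← integral_finsetSum _ fun i _ => (hint i).coe_mul.integrableOn,
      integral_congr_ae (ae_restrict_of_ae e1), integral_sub
        hx1.integrableOn (hint k).coe_mul.integrableOn, hE1,
      integral_congr_ae e2, integral_add_add ((hint k).coe_mul.indicator hEm) hLi.coe_mul hRi.coe_mul,
      integral_indicator hEm]
    ring
  obtain ⟨l, r, hl, hr, hlr0, hlr1, hlrs, hlrz⟩ := exists_nonneg_combination
    (Finset.univ.erase k) (c := fun i => ∫ x in E, β i x ∂μ)
    (d := fun i => ∫ x in E, (x : ℝ) * β i x ∂μ) (a := a) (b := b) hab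
    (integral_nonneg hLn) hL (integral_nonneg hRn) hR hL1 hR1
    (fun i _ => integral_nonneg (h.nonneg i))
    (fun i _ => by
      rw [← integral_const_mul]
      refine setIntegral_mono_on ((hint i).const_mul _).integrableOn (hint i).coe_mul.integrableOn
        hEm fun x hx => mul_le_mul_of_nonneg_right hx.1.1 (h.nonneg i x))
    (fun i _ => by
      rw [← integral_const_mul]
      refine setIntegral_mono_on (hint i).coe_mul.integrableOn ((hint i).const_mul _).integrableOn
        hEm fun x hx => mul_le_mul_of_nonneg_right hx.1.2 (h.nonneg i x))
    hcs hds
  have hmem : ∀ i, i ≠ k → i ∈ Finset.univ.erase k := fun i hi =>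
    Finset.mem_erase.2 ⟨hi, Finset.mem_univ i⟩
  have hlrae : ∀ᵐ x ∂μ, (∑ i ∈ Finset.univ.erase k, l i) * L x +
      (∑ i ∈ Finset.univ.erase k, r i) * R x = L x + R x := by
    rcases hlrs with ⟨h1, h2⟩ | ⟨h1, h2⟩
    · filter_upwards [(integral_eq_zero_iff_of_nonneg hLn hLi).1 h1,
        (integral_eq_zero_iff_of_nonneg hRn hRi).1 h2] with x hx hx'
      simp [hx, hx']
    · simp [h1, h2]
  -- Cell `k` takes all of `E`; each other cell leaves `E` and receives the portions `l i` of `L`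
  -- and `r i` of `R` that restore its mass and moment.
  set β' : Fin n → unitInterval → ℝ := fun i => if i = k then E.indicator 1 else
    fun x => Eᶜ.indicator (β i) x + l i * L x + r i * R x with hβ'
  have hβk : β' k = E.indicator 1 := if_pos rfl
  have hβi : ∀ i, i ≠ k → β' i = fun x => Eᶜ.indicator (β i) x + l i * L x + r i * R x :=
    fun i hi => if_neg hi
  -- The lower cells have no share in `E`, so they lose nothing and their portions are zero. This
  -- keeps cells that are already carved intact.
  have hβlt : ∀ i < k, β' i =ᵐ[μ] β i := fun i hi => by
    rw [hβi i hi.ne]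
    have z : ∀ᵐ x ∂μ, x ∈ E → β i x = 0 := by
      filter_upwards [hlt i hi] with x hx hxE using hx hxE.2
    have z0 : ∫ x in E, β i x ∂μ = 0 := integral_eq_zero_of_ae ((ae_restrict_iff' hEm).2 z)
    have z1 : ∫ x in E, (x : ℝ) * β i x ∂μ = 0 := by
      refine integral_eq_zero_of_ae ((ae_restrict_iff' hEm).2 ?_)
      filter_upwards [z] with x hx hxE
      simp [hx hxE]
    obtain ⟨e1, e2⟩ := hlrz i (hmem i hi.ne) z0 z1
    filter_upwards [z] with x hx
    by_cases hxE : x ∈ E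
    · simp [e1, e2, hxE, hx hxE]
    · simp [e1, e2, hxE]
  refine ⟨a, b, β', ⟨?_, ?_, ?_, ?_⟩, ?_, ?_, hβlt, by rw [hβk],
    min_le_right _ _, fun h' => absurd h' hq⟩
  · intro i
    by_cases hi : i = k
    · subst hi; rw [hβk]; exact measurable_one.indicator hEm
    · rw [hβi i hi]
      exact (((h.measurable i).indicator hEm.compl).add
        (((h.measurable k).indicator measurableSet_Iio).const_mul _)).add
        (((h.measurable k).indicator measurableSet_Ioi).const_mul _)
  · intro i x
    by_cases hi : i = k
    · subst hi; rw [hβk]; exact indicator_nonneg (fun _ _ => zero_le_one) x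
    · rw [hβi i hi]
      exact add_nonneg (add_nonneg (indicator_nonneg (fun x _ => h.nonneg i x) x)
        (mul_nonneg (hl i (hmem i hi)) (hLn x))) (mul_nonneg (hr i (hmem i hi)) (hRn x))
  · filter_upwards [hsum, hsplit, hlrae] with x h1 h2 h3
    rw [← Finset.add_sum_erase _ _ (Finset.mem_univ k), hβk,
      Finset.sum_congr rfl fun i hi => by rw [hβi i (Finset.ne_of_mem_erase hi)],
      Finset.sum_add_distrib, Finset.sum_add_distrib, ← Finset.sum_mul, ← Finset.sum_mul,
      add_assoc (∑ i ∈ _, _), h3]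
    by_cases hx : x ∈ E
    · have e1 : ¬ x < a := hx.1.1.not_gt
      have e2 : ¬ b < x := hx.1.2.not_gt
      simp [hx, hLdef, hRdef, e1, e2]
    · simp only [hx, indicator_of_notMem, not_false_eq_true, mem_compl_iff, indicator_of_mem,
        zero_add] at h2 ⊢
      rw [h1]; linarith
  · intro i
    rcases lt_trichotomy i k with hi | hi | hi
    · filter_upwards [hβlt i hi, h.support i] with x h1 h2 h3
      rw [h1, h2 h3]
    · subst hi
      refine ae_of_all _ fun x hx => ?_
      rw [hβk]
      exact indicator_of_notMem (fun h' => (h'.1.2.trans (min_le_right _ _)).not_gt hx) _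
    -- Higher cells may take over shares of cell `k` because their upper bounds are weaker.
    · filter_upwards [h.support i, h.support k] with x h1 h2 h3
      have e1 := h1 h3
      have e2 := h2 ((hc hi.le).trans_lt h3)
      rw [hβi i hi.ne']
      simp [hLdef, hRdef, indicator_apply, e1, e2]
  · intro i
    by_cases hi : i = k
    · subst hi; rw [hβk, ← hE0, integral_indicator hEm]; rfl
    · rw [hβi i hi, integral_add_add ((hint i).indicator hEm.compl) (hLi.const_mul _) (hRi.const_mul _),
        integral_indicator hEm.compl, integral_const_mul, integral_const_mul, add_assoc,
        hlr0 i (hmem i hi), add_comm, integral_add_compl hEm (hint i)]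
  · intro i
    by_cases hi : i = k
    · subst hi; rw [hβk, ← hE1, ← integral_indicator hEm]
      congr 1; ext x
      by_cases hx : x ∈ E <;> simp [hx]
    · have e : ∀ x : unitInterval, (x : ℝ) * β' i x = Eᶜ.indicator (fun x => (x : ℝ) * β i x) x +
          l i * (x * L x) + r i * (x * R x) := fun x => by
        rw [hβi i hi]
        by_cases hx : x ∈ E <;> simp [hx] <;> ring
      simp_rw [e]
      rw [integral_add_add ((hint i).coe_mul.indicator hEm.compl) (hLi.coe_mul.const_mul _)
        (hRi.coe_mul.const_mul _), integral_indicator hEm.compl, integral_const_mul,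
        integral_const_mul, add_assoc, hlr1 i (hmem i hi), add_comm,
        integral_add_compl hEm (hint i).coe_mul]

end IsFractionalPartition

/-! ### Cells carved successively out of intervals -/

/-- The part of the `i`-th interval that no earlier interval covers. -/
def carvedCell {n : ℕ} (a b : Fin n → unitInterval) (i : Fin n) : Set unitInterval :=
  Icc (a i) (b i) \ ⋃ j < i, Icc (a j) (b j)

section CarvedCell

variable {n : ℕ} {a b : Fin n → unitInterval}

theorem measurableSet_carvedCell (a b : Fin n → unitInterval) (i : Fin n) :
    MeasurableSet (carvedCell a b i) :=
  measurableSet_Icc.diff (MeasurableSet.iUnion fun _ => MeasurableSet.iUnion fun _ =>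
    measurableSet_Icc)

theorem carvedCell_congr {a' b' : Fin n → unitInterval} {i : Fin n}
    (ha : ∀ j ≤ i, a j = a' j) (hb : ∀ j ≤ i, b j = b' j) :
    carvedCell a b i = carvedCell a' b' i := by
  simp only [carvedCell, ha i le_rfl, hb i le_rfl]
  congr 1
  refine iUnion_congr fun j => iUnion_congr fun hj => ?_
  rw [ha j hj.le, hb j hj.le]

theorem exists_mem_carvedCell {x : unitInterval} {i : Fin n} (hx : x ∈ Icc (a i) (b i)) :
    ∃ j ≤ i, x ∈ carvedCell a b j := by
  induction i using WellFoundedLT.induction with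
  | ind i ih =>
    by_cases h : x ∈ ⋃ j < i, Icc (a j) (b j)
    · obtain ⟨j, hj, hxj⟩ := mem_iUnion₂.1 h
      obtain ⟨l, hl, hxl⟩ := ih j hj hxj
      exact ⟨l, hl.trans hj.le, hxl⟩
    · exact ⟨i, le_rfl, hx, h⟩

theorem eq_of_mem_carvedCell {x : unitInterval} {i j : Fin n} (hi : x ∈ carvedCell a b i)
    (hj : x ∈ carvedCell a b j) : i = j := by
  rcases lt_trichotomy i j with h | h | h
  · exact absurd (mem_iUnion₂.2 ⟨i, h, hi.1⟩) hj.2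
  · exact h
  · exact absurd (mem_iUnion₂.2 ⟨j, h, hj.1⟩) hi.2

theorem sum_indicator_carvedCell_le_one (a b : Fin n → unitInterval) (x : unitInterval) :
    ∑ i, (carvedCell a b i).indicator (1 : unitInterval → ℝ) x ≤ 1 := by
  by_cases h : ∃ i, x ∈ carvedCell a b i
  · obtain ⟨i, hi⟩ := h
    rw [Finset.sum_eq_single i (fun j _ hj => indicator_of_notMem
      (fun hxj => hj (eq_of_mem_carvedCell hxj hi)) _) (by simp)]
    exact indicator_le_self' (fun _ _ => zero_le_one) x
  · push Not at h
    rw [Finset.sum_eq_zero fun i _ => indicator_of_notMem (h i) _]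
    exact zero_le_one

/-- Only a state equal to one of the finitely many endpoints can change cells under arbitrarily
small perturbations, and these states are null. -/
theorem continuous_setIntegral_carvedCell {μ : Measure unitInterval} [NullSingletonClass μ]
    {h : unitInterval → ℝ} (hh : Integrable h μ) (i : Fin n) :
    Continuous fun p : (Fin n → unitInterval) × (Fin n → unitInterval) =>
      ∫ x in carvedCell p.1 p.2 i, h x ∂μ := by
  refine continuous_setIntegral_of_ae_eventually
    (E := fun p : (Fin n → unitInterval) × (Fin n → unitInterval) => carvedCell p.1 p.2 i)
    (fun p => measurableSet_carvedCell p.1 p.2 i) (fun p => ?_) hh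
  have hne : ∀ᵐ x ∂μ, ∀ j, x ≠ p.1 j ∧ x ≠ p.2 j := by
    refine ae_all_iff.2 fun j => ?_
    have h1 : ∀ᵐ x ∂μ, x ≠ p.1 j := by simp [ae_iff]
    have h2 : ∀ᵐ x ∂μ, x ≠ p.2 j := by simp [ae_iff]
    filter_upwards [h1, h2] with x hx hx' using ⟨hx, hx'⟩
  filter_upwards [hne] with x hx
  have hev : ∀ᶠ q : (Fin n → unitInterval) × (Fin n → unitInterval) in 𝓝 p,
      ∀ j, (x ∈ Icc (q.1 j) (q.2 j) ↔ x ∈ Icc (p.1 j) (p.2 j)) := by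
    refine eventually_all.2 fun j => ?_
    have t1 : Tendsto (fun q : (Fin n → unitInterval) × (Fin n → unitInterval) => q.1 j)
        (𝓝 p) (𝓝 (p.1 j)) := ((continuous_apply j).comp continuous_fst).tendsto p
    have t2 : Tendsto (fun q : (Fin n → unitInterval) × (Fin n → unitInterval) => q.2 j)
        (𝓝 p) (𝓝 (p.2 j)) := ((continuous_apply j).comp continuous_snd).tendsto p
    filter_upwards [t1.eventually (eventually_ge_iff_of_ne (hx j).1),
      t2.eventually (eventually_le_iff_of_ne (hx j).2)] with q h1 h2
    simp only [mem_Icc, h1, h2]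
  filter_upwards [hev] with q hq
  simp only [carvedCell, Set.mem_sdiff, mem_iUnion, hq]

end CarvedCell

/-! ### Carving all cells, and existence of a maximum -/

namespace IsFractionalPartition

variable {n : ℕ} {μ : Measure unitInterval} {c : Fin n → unitInterval}
  {β β' : Fin n → unitInterval → ℝ}

/-- Convexity is the gain from fractional over deterministic partitions: mixing interpolates
payoffs, and carving afterwards removes the fractions. -/
theorem convexCombination (h : IsFractionalPartition μ c β) (h' : IsFractionalPartition μ c β')
    {s t : ℝ} (hs : 0 ≤ s) (ht : 0 ≤ t) (hst : s + t = 1) :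
    IsFractionalPartition μ c fun i x => s * β i x + t * β' i x where
  measurable i := ((h.measurable i).const_mul s).add ((h'.measurable i).const_mul t)
  nonneg i x := add_nonneg (mul_nonneg hs (h.nonneg i x)) (mul_nonneg ht (h'.nonneg i x))
  sum_eq_one := by
    filter_upwards [h.sum_eq_one, h'.sum_eq_one] with x hx hx'
    rw [Finset.sum_add_distrib, ← Finset.mul_sum, ← Finset.mul_sum, hx, hx', mul_one, mul_one, hst]
  support i := by
    filter_upwards [h.support i, h'.support i] with x hx hx' hlt
    rw [hx hlt, hx' hlt]; simp

/-- Induction on the number of cells already carved, from the lowest up; each step is one exchange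
within the complement of the earlier intervals. -/
theorem exists_carvedCell_initial [IsFiniteMeasure μ] [NullSingletonClass μ]
    (h : IsFractionalPartition μ c β) (hc : Monotone c) (k : ℕ) (hk : k ≤ n) :
    ∃ (a b : Fin n → unitInterval) (β' : Fin n → unitInterval → ℝ),
      IsFractionalPartition μ c β' ∧
      (∀ i, ∫ x, β' i x ∂μ = ∫ x, β i x ∂μ) ∧
      (∀ i, ∫ x, (x : ℝ) * β' i x ∂μ = ∫ x, (x : ℝ) * β i x ∂μ) ∧
      ∀ i : Fin n, (i : ℕ) < k → β' i =ᵐ[μ] (carvedCell a b i).indicator 1 ∧ b i ≤ c i ∧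
        (∫ x, β i x ∂μ = 0 → b i < a i) := by
  induction k with
  | zero => exact ⟨c, c, β, h, fun _ => rfl, fun _ => rfl, fun _ hi => absurd hi (Nat.not_lt_zero _)⟩
  | succ k ih =>
    obtain ⟨a, b, β', h', hm0, hm1, hcell⟩ := ih (Nat.le_of_succ_le hk)
    set K : Fin n := ⟨k, hk⟩ with hK
    have hltK : ∀ i : Fin n, i < K → (i : ℕ) < k := fun i hi => hi
    set D : Set unitInterval := (⋃ j < K, Icc (a j) (b j))ᶜ with hD
    have hDm : MeasurableSet D := (MeasurableSet.iUnion fun _ => MeasurableSet.iUnion fun _ =>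
      measurableSet_Icc).compl
    have hall : ∀ᵐ x ∂μ, ∀ i < K, β' i x = (carvedCell a b i).indicator 1 x :=
      ae_all_iff.2 fun i => by
        by_cases hi : i < K
        · filter_upwards [(hcell i (hltK i hi)).1] with x hx _ using hx
        · exact ae_of_all _ fun x hx => absurd hx hi
    obtain ⟨a₀, b₀, β'', h'', e0, e1, hlt, hE, hb, hz⟩ := h'.exists_Icc_exchange hc K hDm
      (fun i hi => by
        filter_upwards [hall] with x hx hxD
        rw [hx i hi]
        exact indicator_of_notMem (fun hc => hxD (mem_iUnion₂.2 ⟨i, hi, hc.1⟩)) _)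
      (by
        -- A state outside `D` lies in some earlier carved cell, which already takes its whole
        -- share.
        filter_upwards [hall, h'.sum_eq_one] with x hx hs hxD
        obtain ⟨i, hi, hxi⟩ := mem_iUnion₂.1 (not_not.1 hxD)
        obtain ⟨j, hj, hxj⟩ := exists_mem_carvedCell hxi
        have hjK : j < K := hj.trans_lt hi
        have h1 : β' j x = 1 := by rw [hx j hjK, indicator_of_mem hxj]; rfl
        have h2 : β' j x + β' K x ≤ ∑ i, β' i x := by
          rw [← Finset.sum_pair (f := fun i => β' i x) hjK.ne]
          exact Finset.sum_le_sum_of_subset_of_nonneg (Finset.subset_univ _)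
            fun i _ _ => h'.nonneg i x
        have h3 := h'.nonneg K x
        linarith)
    have ha' : ∀ j < K, Function.update a K a₀ j = a j := fun j hj =>
      Function.update_of_ne hj.ne _ _
    have hb' : ∀ j < K, Function.update b K b₀ j = b j := fun j hj =>
      Function.update_of_ne hj.ne _ _
    refine ⟨Function.update a K a₀, Function.update b K b₀, β'', h'', fun i => (e0 i).trans (hm0 i),
      fun i => (e1 i).trans (hm1 i), fun i hi => ?_⟩
    rcases (Nat.lt_succ_iff_lt_or_eq.1 hi) with hi | hi
    · have hiK : i < K := hi
      obtain ⟨h1, h2, h3⟩ := hcell i hi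
      rw [ha' i hiK, hb' i hiK, carvedCell_congr (fun j hj => ha' j (hj.trans_lt hiK))
        (fun j hj => hb' j (hj.trans_lt hiK))]
      exact ⟨(hlt i hiK).trans h1, h2, h3⟩
    · have hiK : i = K := Fin.ext hi
      subst hiK
      rw [Function.update_self, Function.update_self, ← hm0]
      refine ⟨?_, hb, hz⟩
      have : carvedCell (Function.update a K a₀) (Function.update b K b₀) K = Icc a₀ b₀ ∩ D := by
        rw [carvedCell, Function.update_self, Function.update_self, Set.sdiff_eq, hD]
        congr 2
        refine iUnion_congr fun j => iUnion_congr fun hj => ?_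
        rw [ha' j hj, hb' j hj]
      rw [this]; exact hE

/-- Every fractional partition has the same masses and first moments as a partition into
successively carved intervals. -/
theorem exists_carvedCell [IsFiniteMeasure μ] [NullSingletonClass μ]
    (h : IsFractionalPartition μ c β) (hc : Monotone c) :
    ∃ a b : Fin n → unitInterval,
      IsFractionalPartition μ c (fun i => (carvedCell a b i).indicator 1) ∧
      (∀ i, ∫ _ in carvedCell a b i, (1 : ℝ) ∂μ = ∫ x, β i x ∂μ) ∧
      (∀ i, ∫ x in carvedCell a b i, (x : ℝ) ∂μ = ∫ x, (x : ℝ) * β i x ∂μ) ∧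
      (∀ i, b i ≤ c i) ∧ ∀ i, ∫ x, β i x ∂μ = 0 → b i < a i := by
  obtain ⟨a, b, β', h', hm0, hm1, hcell⟩ := h.exists_carvedCell_initial hc n le_rfl
  have hall : ∀ᵐ x ∂μ, ∀ i, β' i x = (carvedCell a b i).indicator 1 x :=
    ae_all_iff.2 fun i => (hcell i i.2).1
  refine ⟨a, b, ⟨fun i => measurable_one.indicator (measurableSet_carvedCell a b i),
    fun i => indicator_nonneg fun _ _ => zero_le_one, ?_, fun i => ?_⟩, fun i => ?_, fun i => ?_,
    fun i => (hcell i i.2).2.1, fun i => (hcell i i.2).2.2⟩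
  · filter_upwards [hall, h'.sum_eq_one] with x hx hs
    simp_rw [← hx, hs]
  · filter_upwards [hall, h'.support i] with x hx hs hlt
    rw [← hx, hs hlt]
  · rw [← hm0, ← integral_indicator (measurableSet_carvedCell a b i)]
    refine integral_congr_ae ?_
    filter_upwards [hall] with x hx
    rw [hx]; rfl
  · rw [← hm1, ← integral_indicator (measurableSet_carvedCell a b i)]
    refine integral_congr_ae ?_
    filter_upwards [hall] with x hx
    rw [hx]
    by_cases hxi : x ∈ carvedCell a b i <;> simp [hxi]

/-- A linear objective attains its maximum excess the fractional partitions whose cells have means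
above given bounds. -/
theorem exists_isGreatest [IsProbabilityMeasure μ] [NullSingletonClass μ] (hc : Monotone c)
    (g v : Fin n → ℝ) (hβ : IsFractionalPartition μ c β)
    (hg : ∀ i, g i * ∫ x, β i x ∂μ ≤ ∫ x, (x : ℝ) * β i x ∂μ) :
    ∃ S, IsGreatest {S | ∃ β, IsFractionalPartition μ c β ∧
      (∀ i, g i * ∫ x, β i x ∂μ ≤ ∫ x, (x : ℝ) * β i x ∂μ) ∧ ∑ i, v i * ∫ x, β i x ∂μ = S} S := by
  have hx1 : Integrable (fun x : unitInterval => (x : ℝ)) μ := by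
    simpa using (integrable_const (1 : ℝ)).coe_mul (μ := μ)
  have hcont : ∀ h : unitInterval → ℝ, Integrable h μ → ∀ i : Fin n, Continuous fun p :
      (Fin n → unitInterval) × (Fin n → unitInterval) => ∫ x in carvedCell p.1 p.2 i, h x ∂μ :=
    fun h hh i => continuous_setIntegral_carvedCell hh i
  set mass : (Fin n → unitInterval) × (Fin n → unitInterval) → Fin n → ℝ :=
    fun p i => ∫ _ in carvedCell p.1 p.2 i, (1 : ℝ) ∂μ with hmass
  set moment : (Fin n → unitInterval) × (Fin n → unitInterval) → Fin n → ℝ :=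
    fun p i => ∫ x in carvedCell p.1 p.2 i, (x : ℝ) ∂μ with hmoment
  set excess : (Fin n → unitInterval) × (Fin n → unitInterval) → Fin n → ℝ :=
    fun p i => ∫ x in carvedCell p.1 p.2 i, (Ioi (c i)).indicator 1 x ∂μ with hexcess
  have hi1 : ∀ i, Integrable ((Ioi (c i)).indicator (1 : unitInterval → ℝ)) μ := fun i =>
    (integrable_const (1 : ℝ)).indicator measurableSet_Ioi
  have c0 : ∀ i, Continuous fun p => mass p i := fun i => hcont _ (integrable_const 1) i
  have c1 : ∀ i, Continuous fun p => moment p i := fun i => hcont _ hx1 i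
  have c2 : ∀ i, Continuous fun p => excess p i := fun i => hcont _ (hi1 i) i
  -- Feasibility in terms of endpoints, by closed conditions: the cells exhaust the mass, satisfy
  -- the mean bounds, and have no mass above their upper bounds.
  set T : Set ((Fin n → unitInterval) × (Fin n → unitInterval)) :=
    {p | ∑ i, mass p i = 1} ∩ ((⋂ i, {p | g i * mass p i ≤ moment p i}) ∩
      ⋂ i, {p | excess p i = 0}) with hT
  have hTc : IsCompact T := by
    refine IsClosed.isCompact ?_
    refine (isClosed_eq (continuous_finsetSum _ fun i _ => c0 i) continuous_const).inter
      ((isClosed_iInter fun i => isClosed_le (continuous_const.mul (c0 i)) (c1 i)).inter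
        (isClosed_iInter fun i => isClosed_eq (c2 i) continuous_const))
  have hind0 : ∀ p i, ∫ x, (carvedCell p.1 p.2 i).indicator (1 : unitInterval → ℝ) x ∂μ =
      mass p i := fun p i => integral_indicator (measurableSet_carvedCell p.1 p.2 i)
  have hind1 : ∀ p i, ∫ x, (x : ℝ) * (carvedCell p.1 p.2 i).indicator (1 : unitInterval → ℝ) x ∂μ =
      moment p i := fun p i => by
    simp only [hmoment]
    rw [← integral_indicator (measurableSet_carvedCell p.1 p.2 i)]
    congr 1; ext x
    by_cases hxi : x ∈ carvedCell p.1 p.2 i <;> simp [hxi]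
  have hofT : ∀ p ∈ T, IsFractionalPartition μ c fun i => (carvedCell p.1 p.2 i).indicator 1 := by
    intro p hp
    refine ⟨fun i => measurable_one.indicator (measurableSet_carvedCell _ _ i),
      fun i => indicator_nonneg fun _ _ => zero_le_one, ?_, fun i => ?_⟩
    · have hii : ∀ i, Integrable ((carvedCell p.1 p.2 i).indicator (1 : unitInterval → ℝ)) μ :=
        fun i => (integrable_const (1 : ℝ)).indicator (measurableSet_carvedCell _ _ i)
      have hs : Integrable (fun x => ∑ i, (carvedCell p.1 p.2 i).indicator
          (1 : unitInterval → ℝ) x) μ := integrable_finsetSum _ fun i _ => hii i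
      -- Carved cells are disjoint, so the integrand is nonnegative; total mass one then makes them
      -- cover almost every state.
      have h0 : ∫ x, (1 - ∑ i, (carvedCell p.1 p.2 i).indicator (1 : unitInterval → ℝ) x) ∂μ = 0 := by
        rw [integral_sub (integrable_const 1) hs, integral_finsetSum _ fun i _ => hii i]
        simp_rw [hind0]
        have : ∑ i, mass p i = 1 := hp.1
        simp [this]
      have h1 := (integral_eq_zero_iff_of_nonneg
        (fun x => sub_nonneg.2 (sum_indicator_carvedCell_le_one p.1 p.2 x))
        ((integrable_const 1).sub hs)).1 h0
      filter_upwards [h1] with x hx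
      simp only [Pi.zero_apply] at hx
      linarith
    · have h0 : excess p i = 0 := mem_iInter.1 hp.2.2 i
      simp only [hexcess] at h0
      have hnn : 0 ≤ (carvedCell p.1 p.2 i).indicator
          ((Ioi (c i)).indicator (1 : unitInterval → ℝ)) :=
        fun x => indicator_nonneg (fun _ _ => indicator_nonneg (fun _ _ => zero_le_one) _) _
      rw [← integral_indicator (measurableSet_carvedCell _ _ i), integral_eq_zero_iff_of_nonneg
        hnn ((hi1 i).indicator (measurableSet_carvedCell _ _ i))] at h0
      filter_upwards [h0] with x hx hlt
      refine indicator_of_notMem (fun hxi => ?_) _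
      rw [indicator_of_mem hxi, indicator_of_mem (show x ∈ Ioi (c i) from hlt)] at hx
      exact one_ne_zero hx
  have hset : {S | ∃ β, IsFractionalPartition μ c β ∧
      (∀ i, g i * ∫ x, β i x ∂μ ≤ ∫ x, (x : ℝ) * β i x ∂μ) ∧ ∑ i, v i * ∫ x, β i x ∂μ = S} =
      (fun p => ∑ i, v i * mass p i) '' T := by
    ext S
    constructor
    · rintro ⟨β, h, hg, rfl⟩
      obtain ⟨a, b, hcell, hm0, hm1, -, -⟩ := h.exists_carvedCell hc
      refine ⟨(a, b), ⟨?_, mem_iInter.2 fun i => ?_, mem_iInter.2 fun i => ?_⟩, ?_⟩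
      · change ∑ i, mass (a, b) i = 1
        simp_rw [← hind0]
        rw [← integral_finsetSum _ fun i _ => hcell.integrable i,
          integral_congr_ae hcell.sum_eq_one]
        simp
      · change g i * mass (a, b) i ≤ moment (a, b) i
        simp only [hmass, hmoment, hm0, hm1]
        exact hg i
      · refine integral_eq_zero_of_ae ((ae_restrict_iff' (measurableSet_carvedCell a b i)).2 ?_)
        filter_upwards [hcell.support i] with x hx hxi
        refine indicator_of_notMem (fun hlt => ?_) _
        have := hx hlt
        rw [indicator_of_mem hxi] at this
        exact one_ne_zero this
      · simp only [hmass, hm0]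
    · rintro ⟨p, hp, rfl⟩
      refine ⟨_, hofT p hp, fun i => ?_, ?_⟩
      · rw [hind0, hind1]
        exact mem_iInter.1 hp.2.1 i
      · simp only [hind0]
  rw [hset]
  refine (hTc.image ?_).exists_isGreatest ?_
  · exact continuous_finsetSum _ fun i _ => continuous_const.mul (c0 i)
  · rw [← hset]
    exact ⟨_, β, hβ, hg, rfl⟩

end IsFractionalPartition

/-! ### Closures of carved cells: laminarity and null overlaps -/

/-- The order-convex hull of a set of states, as a set of states. -/
def orderHull (S : Set unitInterval) : Set unitInterval :=
  {x | (∃ a ∈ S, a ≤ x) ∧ ∃ b ∈ S, x ≤ b}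

theorem subset_orderHull (S : Set unitInterval) : S ⊆ orderHull S :=
  fun x hx => ⟨⟨x, hx, le_rfl⟩, ⟨x, hx, le_rfl⟩⟩

theorem stateHull_eq_image_orderHull (S : Set unitInterval) :
    stateHull S = (fun x : unitInterval => (x : ℝ)) '' orderHull S := by
  apply Subset.antisymm
  · refine convexHull_min (image_mono (subset_orderHull S)) (OrdConnected.convex ⟨?_⟩)
    rintro _ ⟨x, ⟨⟨a, ha, hax⟩, -⟩, rfl⟩ _ ⟨y, ⟨-, ⟨b, hb, hyb⟩⟩, rfl⟩ z ⟨hz1, hz2⟩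
    exact ⟨⟨z, x.2.1.trans hz1, hz2.trans y.2.2⟩,
      ⟨⟨a, ha, hax.trans (Subtype.coe_le_coe.1 hz1)⟩,
        ⟨b, hb, le_trans (Subtype.coe_le_coe.1 hz2) hyb⟩⟩, rfl⟩
  · rintro _ ⟨x, ⟨⟨a, ha, hax⟩, ⟨b, hb, hxb⟩⟩, rfl⟩
    have hc : Convex ℝ (stateHull S) := convex_convexHull ℝ _
    have h1 : (a : ℝ) ∈ stateHull S := subset_convexHull ℝ _ ⟨a, ha, rfl⟩
    have h2 : (b : ℝ) ∈ stateHull S := subset_convexHull ℝ _ ⟨b, hb, rfl⟩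
    exact hc.ordConnected.out h1 h2 ⟨hax, hxb⟩

section CarvedCell

variable {n : ℕ} {a b : Fin n → unitInterval}

theorem closure_carvedCell_subset (a b : Fin n → unitInterval) (i : Fin n) :
    closure (carvedCell a b i) ⊆ Icc (a i) (b i) :=
  closure_minimal sdiff_subset isClosed_Icc

theorem orderHull_closure_carvedCell_subset (a b : Fin n → unitInterval) (i : Fin n) :
    orderHull (closure (carvedCell a b i)) ⊆ Icc (a i) (b i) :=
  fun _ ⟨⟨_, hy, hyx⟩, ⟨_, hz, hxz⟩⟩ => ⟨(closure_carvedCell_subset a b i hy).1.trans hyx,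
    hxz.trans (closure_carvedCell_subset a b i hz).2⟩

/-- The hull of a cell may be smaller than its interval, but every point of the interval lies in an
equal or earlier cell. Hence the earlier hulls and the earlier intervals have the same union. -/
theorem isLaminar_closure_carvedCell (a b : Fin n → unitInterval) :
    IsLaminar fun i => closure (carvedCell a b i) := by
  intro i
  have hunion : ⋃ k < i, orderHull (closure (carvedCell a b k)) = ⋃ k < i, Icc (a k) (b k) := by
    apply Subset.antisymm
    · exact iUnion₂_mono fun k _ => orderHull_closure_carvedCell_subset a b k
    · refine iUnion₂_subset fun k hk x hx => ?_
      obtain ⟨j, hj, hxj⟩ := exists_mem_carvedCell hx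
      exact mem_iUnion₂.2 ⟨j, hj.trans_lt hk, subset_orderHull _ (subset_closure hxj)⟩
  have hdiff : orderHull (closure (carvedCell a b i)) \
      ⋃ k < i, orderHull (closure (carvedCell a b k)) = carvedCell a b i := by
    rw [hunion]
    apply Subset.antisymm
    · exact sdiff_subset_sdiff_left (orderHull_closure_carvedCell_subset a b i)
    · exact fun x hx => ⟨subset_orderHull _ (subset_closure hx), hx.2⟩
  simp only [stateHull_eq_image_orderHull]
  rw [← image_iUnion₂, ← image_sdiff Subtype.val_injective, hdiff]
  exact ((isClosed_Icc.isClosedEmbedding_subtypeVal).closure_image_eq _).symm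

/-- Cell `i` avoids the open interior of an earlier interval, and so does its closure. -/
theorem closure_carvedCell_inter_Icc_subset {i j : Fin n} (hj : j < i) :
    closure (carvedCell a b i) ∩ Icc (a j) (b j) ⊆ {a j, b j} := by
  rintro x ⟨hx, hxj⟩
  by_contra hne
  have hx' : x ∈ Ioo (a j) (b j) :=
    ⟨lt_of_le_of_ne hxj.1 fun h => hne (Or.inl h.symm), lt_of_le_of_ne hxj.2 fun h => hne (Or.inr h)⟩
  obtain ⟨y, hy, hyi⟩ := mem_closure_iff.1 hx _ isOpen_Ioo hx'
  exact hyi.2 (mem_iUnion₂.2 ⟨j, hj, Ioo_subset_Icc_self hy⟩)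

variable {μ : Measure unitInterval}

theorem measure_closure_carvedCell_inter [NullSingletonClass μ] {i j : Fin n} (hij : i ≠ j) :
    μ (closure (carvedCell a b i) ∩ closure (carvedCell a b j)) = 0 := by
  wlog hlt : j < i generalizing i j
  · rw [inter_comm]
    exact this hij.symm (lt_of_le_of_ne (not_lt.1 hlt) hij)
  · refine measure_mono_null ?_ ((toFinite {a j, b j}).measure_zero μ)
    exact (inter_subset_inter_right _ (closure_carvedCell_subset a b j)).trans
      (closure_carvedCell_inter_Icc_subset hlt)

theorem closure_carvedCell_ae_eq [NullSingletonClass μ] (i : Fin n) :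
    closure (carvedCell a b i) =ᵐ[μ] carvedCell a b i := by
  refine (subset_closure.eventuallyLE.antisymm ?_).symm
  rw [ae_le_set]
  have hsub : closure (carvedCell a b i) \ carvedCell a b i ⊆
      ⋃ j : Fin n, ({a j, b j} : Set unitInterval) := by
    rintro x ⟨hx, hxi⟩
    by_contra hne
    refine hxi ⟨closure_carvedCell_subset a b i hx, fun hu => ?_⟩
    obtain ⟨j, hj, hxj⟩ := mem_iUnion₂.1 hu
    exact hne (mem_iUnion.2 ⟨j, closure_carvedCell_inter_Icc_subset hj ⟨hx, hxj⟩⟩)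
  exact measure_mono_null hsub ((finite_iUnion fun j => toFinite _).measure_zero μ)

/-- The union is closed and has full measure, so its complement is an open null set, hence empty. -/
theorem iUnion_closure_carvedCell [μ.IsOpenPosMeasure]
    (h : ∀ᵐ x ∂μ, ∑ i, (carvedCell a b i).indicator (1 : unitInterval → ℝ) x = 1) :
    ⋃ i, closure (carvedCell a b i) = univ := by
  have hclosed : IsClosed (⋃ i, closure (carvedCell a b i)) :=
    isClosed_iUnion_of_finite fun i => isClosed_closure
  rw [← compl_empty_iff]
  by_contra hne
  have hpos := hclosed.isOpen_compl.measure_pos μ (nonempty_iff_ne_empty.2 hne)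
  refine hpos.ne' (measure_mono_null (fun x hx => ?_) (ae_iff.1 h))
  intro hs
  rw [Finset.sum_eq_zero fun i _ => indicator_of_notMem (fun hxi =>
    hx (mem_iUnion.2 ⟨i, subset_closure hxi⟩)) _] at hs
  exact zero_ne_one hs

end CarvedCell

/-! ### Lowest state of a message, for skeptical beliefs -/

/-- The lowest state that a message deems possible. -/
noncomputable def minState (m : Message) : unitInterval := sInf (m : Set unitInterval)

theorem minState_mem (m : Message) : minState m ∈ m := m.isCompact.sInf_mem m.nonempty

theorem minState_le {m : Message} {x : unitInterval} (hx : x ∈ m) : minState m ≤ x := sInf_le hx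

theorem minState_singleton (x : unitInterval) : minState ({x} : Message) = x := by
  simp [minState]

theorem measurable_minState : Measurable minState := by
  refine measurable_of_Iio fun c => ?_
  have : minState ⁻¹' Iio c = {m : Message | ((m : Set unitInterval) ∩ Iio c).Nonempty} := by
    ext m
    exact ⟨fun h => ⟨minState m, minState_mem m, h⟩, fun ⟨x, hx, hxc⟩ => (minState_le hx).trans_lt hxc⟩
  rw [this]
  exact (TopologicalSpace.NonemptyCompacts.isOpen_inter_nonempty_of_isOpen isOpen_Iio).measurableSet

/-! ### The prior and the lowest optimal action -/

namespace DisclosureGame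

variable {n : ℕ} (G : DisclosureGame n)

theorem measurable_ofReal_f : Measurable fun ω => ENNReal.ofReal (G.f ω) :=
  G.measurable_f.ennreal_ofReal

instance isProbabilityMeasure_prior : IsProbabilityMeasure G.prior :=
  ⟨by rw [prior, withDensity_apply _ MeasurableSet.univ, Measure.restrict_univ, G.lintegral_f]⟩

instance nullSingletonClass_prior : NullSingletonClass G.prior :=
  ⟨fun x => withDensity_absolutelyContinuous _ _ (measure_singleton x)⟩

instance isOpenPosMeasure_prior : G.prior.IsOpenPosMeasure := by
  refine ⟨fun U hU ⟨x, hx⟩ h0 => ?_⟩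
  rw [prior, withDensity_apply_eq_zero' G.measurable_ofReal_f.aemeasurable] at h0
  have hset : {ω | ENNReal.ofReal (G.f ω) ≠ 0} ∩ U = U :=
    inter_eq_right.2 fun ω _ => (ENNReal.ofReal_pos.2 (G.f_pos ω)).ne'
  rw [hset, unitInterval.volume_apply] at h0
  obtain ⟨V, hV, rfl⟩ := isOpen_induced_iff.1 hU
  have hcl : (x : ℝ) ∈ closure (Ioo (0 : ℝ) 1) := by
    rw [closure_Ioo zero_ne_one]; exact x.2
  -- A relatively open set around an endpoint still meets the open interval, where Lebesgue measure
  -- on `ℝ` charges it.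
  have hne : (V ∩ Ioo (0 : ℝ) 1).Nonempty := mem_closure_iff.1 hcl V hV hx
  refine ((hV.inter isOpen_Ioo).measure_pos volume hne).ne' (measure_mono_null ?_ h0)
  exact fun y hy => ⟨⟨y, Ioo_subset_Icc_self hy.2⟩, hy.1, rfl⟩

theorem cutoff_mem (j : Fin (n + 1)) : G.γ j ∈ unitInterval :=
  ⟨by rw [← G.γ_zero]; exact G.γ_mono (Fin.zero_le j),
    by rw [← G.γ_last]; exact G.γ_mono (Fin.le_last j)⟩

/-- The highest posterior mean at which an action is optimal, as a state. -/
def upperCutoff (i : Fin n) : unitInterval := ⟨G.γ i.succ, G.cutoff_mem _⟩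

theorem upperCutoff_mono : Monotone G.upperCutoff :=
  fun _ _ hij => Subtype.coe_le_coe.1 (G.γ_mono (Fin.succ_le_succ_iff.2 hij))

theorem exists_isLeast_le_upperCutoff (x : unitInterval) :
    ∃ i, IsLeast {i | x ≤ G.upperCutoff i} i := by
  have hne : {i : Fin n | x ≤ G.upperCutoff i}.Nonempty := by
    rcases n with _ | n
    · have h0 := G.γ_zero
      have h1 := G.γ_last
      rw [show Fin.last 0 = 0 from rfl, h0] at h1
      exact absurd h1 zero_ne_one
    · refine ⟨Fin.last n, ?_⟩
      have : G.upperCutoff (Fin.last n) = 1 := Subtype.ext (by simp [upperCutoff, G.γ_last])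
      rw [mem_ofPred_eq, this]
      exact unitInterval.le_one'
  obtain ⟨i, hi, hmin⟩ := WellFounded.has_min (wellFounded_lt (α := Fin n)) _ hne
  exact ⟨i, hi, fun j hj => not_lt.1 (hmin j hj)⟩

/-- Receiver's lowest optimal action when the posterior mean is `x`. -/
noncomputable def lowestAction (x : unitInterval) : Fin n :=
  (G.exists_isLeast_le_upperCutoff x).choose

theorem le_upperCutoff_lowestAction (x : unitInterval) : x ≤ G.upperCutoff (G.lowestAction x) :=
  (G.exists_isLeast_le_upperCutoff x).choose_spec.1

theorem lowestAction_le {x : unitInterval} {i : Fin n} (h : x ≤ G.upperCutoff i) :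
    G.lowestAction x ≤ i :=
  (G.exists_isLeast_le_upperCutoff x).choose_spec.2 h

theorem lowestAction_mono : Monotone G.lowestAction :=
  fun _ y hxy => G.lowestAction_le (hxy.trans (G.le_upperCutoff_lowestAction y))

theorem measurable_lowestAction : Measurable G.lowestAction := by
  refine measurable_to_countable' fun i => OrdConnected.measurableSet ⟨?_⟩
  intro x hx y hy z hz
  rw [mem_preimage, mem_singleton_iff] at hx hy ⊢
  exact le_antisymm (hy ▸ G.lowestAction_mono hz.2) (hx ▸ G.lowestAction_mono hz.1)

theorem coe_mem_A_lowestAction (x : unitInterval) : (x : ℝ) ∈ G.A (G.lowestAction x) := by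
  refine ⟨?_, G.le_upperCutoff_lowestAction x⟩
  by_contra hlt
  push Not at hlt
  set i := G.lowestAction x with hi
  have hpos : 0 < (i : ℕ) := by
    rw [Nat.pos_iff_ne_zero]
    intro h0
    have : i.castSucc = 0 := Fin.ext h0
    rw [this, G.γ_zero] at hlt
    exact hlt.not_ge x.2.1
  set j : Fin n := ⟨i - 1, (Nat.sub_le _ _).trans_lt i.2⟩ with hj
  have hji : j.succ = i.castSucc := Fin.ext (by simp [hj]; omega)
  have hle : G.lowestAction x ≤ j := G.lowestAction_le (by
    have hγ : (G.upperCutoff j : ℝ) = G.γ i.castSucc := congrArg G.γ hji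
    rw [← Subtype.coe_le_coe, hγ]; exact hlt.le)
  have hle' : (i : ℕ) ≤ (i : ℕ) - 1 := hle
  omega

theorem lowestAction_le_of_coe_mem_A {x : unitInterval} {i : Fin n} (h : (x : ℝ) ∈ G.A i) :
    G.lowestAction x ≤ i := G.lowestAction_le h.2

/-- Ties between actions occur only at the finitely many cutoffs. This is why tie-breaking does not
affect the unraveling payoff. -/
theorem ae_eq_lowestAction : ∀ᵐ x : unitInterval ∂G.prior, ∀ i, (x : ℝ) ∈ G.A i → i = G.lowestAction x := by
  have hne : ∀ᵐ x ∂G.prior, ∀ j, x ≠ G.upperCutoff j :=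
    ae_all_iff.2 fun j => by simp [ae_iff]
  filter_upwards [hne] with x hx i hi
  refine le_antisymm (not_lt.1 fun hlt => hx (G.lowestAction x) ?_)
    (G.lowestAction_le_of_coe_mem_A hi)
  refine le_antisymm (G.le_upperCutoff_lowestAction x) (Subtype.coe_le_coe.1 (le_trans ?_ hi.1))
  exact G.γ_mono (Fin.succ_le_castSucc_iff.2 hlt)

/-! ### Payoffs -/

variable (e : Assessment n)

theorem sum_real_singleton (m : Message) : ∑ i, (e.τ m).real {i} = 1 := by
  have := e.markov_τ
  rw [sum_measureReal_singleton]
  simp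

theorem measurable_messagePayoff : Measurable (G.messagePayoff e) :=
  Finset.measurable_sum _ fun i _ =>
    (Kernel.measurable_coe e.τ (measurableSet_singleton i)).ennreal_toReal.mul_const _

variable {e}

theorem le_messagePayoff {m : Message} {y : ℝ} (h : ∀ i, 0 < e.τ m {i} → y ≤ G.v i) :
    y ≤ G.messagePayoff e m := by
  rw [← mul_one y, ← sum_real_singleton e m, Finset.mul_sum]
  refine Finset.sum_le_sum fun i _ => ?_
  rw [mul_comm]
  by_cases hi : 0 < e.τ m {i}
  · exact mul_le_mul_of_nonneg_left (h i hi) measureReal_nonneg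
  · simp [measureReal_def, nonpos_iff_eq_zero.1 (not_lt.1 hi)]

theorem messagePayoff_le {m : Message} {y : ℝ} (h : ∀ i, 0 < e.τ m {i} → G.v i ≤ y) :
    G.messagePayoff e m ≤ y := by
  rw [← mul_one y, ← sum_real_singleton e m, Finset.mul_sum]
  refine Finset.sum_le_sum fun i _ => ?_
  rw [mul_comm y]
  by_cases hi : 0 < e.τ m {i}
  · exact mul_le_mul_of_nonneg_left (h i hi) measureReal_nonneg
  · simp [measureReal_def, nonpos_iff_eq_zero.1 (not_lt.1 hi)]

variable (e)

theorem abs_messagePayoff_le (m : Message) : |G.messagePayoff e m| ≤ ∑ i, |G.v i| :=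
  abs_le.2 ⟨G.le_messagePayoff fun i _ => (neg_le_neg (Finset.single_le_sum
      (f := fun i => |G.v i|) (fun _ _ => abs_nonneg _) (Finset.mem_univ i))).trans (neg_abs_le _),
    G.messagePayoff_le fun i _ => (le_abs_self _).trans (Finset.single_le_sum
      (f := fun i => |G.v i|) (fun _ _ => abs_nonneg _) (Finset.mem_univ i))⟩

theorem integrable_messagePayoff (ω : unitInterval) : Integrable (G.messagePayoff e) (e.σ ω) := by
  have := e.markov_σ
  exact Integrable.of_bound (G.measurable_messagePayoff e).aestronglyMeasurable _
    (ae_of_all _ fun m => G.abs_messagePayoff_le e m)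

theorem integrable_integral_messagePayoff :
    Integrable (fun ω => ∫ m, G.messagePayoff e m ∂(e.σ ω)) G.prior := by
  have := e.markov_σ
  refine Integrable.of_bound (C := ∑ i, |G.v i|)
    (StronglyMeasurable.integral_kernel
      (G.measurable_messagePayoff e).stronglyMeasurable).aestronglyMeasurable
    (ae_of_all _ fun ω => ?_)
  have := norm_integral_le_of_norm_le_const (μ := e.σ ω) (f := G.messagePayoff e)
    (ae_of_all _ fun m => G.abs_messagePayoff_le e m)
  simpa using this

theorem integrable_comp_fin {α : Type*} [MeasurableSpace α] {μ : Measure α} [IsFiniteMeasure μ]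
    {g : α → Fin n} (hg : Measurable g) (v : Fin n → ℝ) : Integrable (fun x => v (g x)) μ :=
  Integrable.of_bound (C := ∑ i, |v i|) ((measurable_of_countable v).comp hg).aestronglyMeasurable
    (ae_of_all _ fun x => Finset.single_le_sum (f := fun i => |v i|) (fun _ _ => abs_nonneg _)
      (Finset.mem_univ (g x)))

theorem integral_comp_fin {α : Type*} [MeasurableSpace α] {μ : Measure α} [IsFiniteMeasure μ]
    {g : α → Fin n} (hg : Measurable g) (v : Fin n → ℝ) :
    ∫ x, v (g x) ∂μ = ∑ i, v i * μ.real {x | g x = i} := by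
  have hm : ∀ i, MeasurableSet {x | g x = i} := fun i => hg (measurableSet_singleton i)
  have h : ∀ x, v (g x) = ∑ i, {x | g x = i}.indicator (fun _ => v i) x := fun x => by
    rw [Finset.sum_eq_single (g x)]
    · simp
    · intro i _ hi
      exact indicator_of_notMem (fun h : g x = i => hi h.symm) _
    · simp
  simp_rw [h]
  rw [integral_finsetSum _ fun i _ => (integrable_const (v i)).indicator (hm i)]
  refine Finset.sum_congr rfl fun i _ => ?_
  rw [integral_indicator_const _ (hm i), smul_eq_mul, mul_comm]

/-! ### Lower and upper bounds on equilibrium payoffs -/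

/-- Sender's payoff when Receiver learns the state and breaks ties against Sender. -/
noncomputable def unravelingPayoff : ℝ := ∫ ω, G.v (G.lowestAction ω) ∂G.prior

variable {G} {e}

theorem IsEquilibrium.mem_A_of_singleton (he : G.IsEquilibrium e) {ω : unitInterval} {i : Fin n}
    (hi : 0 < e.τ {ω} {i}) : (ω : ℝ) ∈ G.A i := by
  have := e.markov_p
  have h := he.receiver_optimal {ω} i hi
  have hae : ∀ᵐ x : unitInterval ∂(e.p {ω}), (x : ℝ) = ω := by
    filter_upwards [he.belief_verifiable {ω}] with x hx
    have : x = ω := by simpa [← SetLike.mem_coe] using hx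
    rw [this]
  rw [integral_congr_ae hae] at h
  simpa using h

theorem IsEquilibrium.le_messagePayoff_singleton (he : G.IsEquilibrium e) (ω : unitInterval) :
    G.v (G.lowestAction ω) ≤ G.messagePayoff e {ω} :=
  G.le_messagePayoff fun _ hi =>
    G.v_strictMono.monotone (G.lowestAction_le_of_coe_mem_A (he.mem_A_of_singleton hi))

theorem IsEquilibrium.unravelingPayoff_le (he : G.IsEquilibrium e) :
    G.unravelingPayoff ≤ G.payoff e := by
  have := e.markov_σ
  refine integral_mono (integrable_comp_fin G.measurable_lowestAction G.v)
    (G.integrable_integral_messagePayoff e) fun ω => ?_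
  have h : ∀ᵐ m ∂(e.σ ω), G.v (G.lowestAction ω) ≤ G.messagePayoff e m := by
    filter_upwards [he.sender_optimal ω] with m hm
    exact (he.le_messagePayoff_singleton ω).trans (hm.2 {ω} (by simp [← SetLike.mem_coe]))
  have := integral_mono_ae (integrable_const _) (G.integrable_messagePayoff e ω) h
  simpa using this

theorem IsEquilibrium.payoff_eq_unravelingPayoff (he : G.IsEquilibrium e)
    (hσ : ∀ ω : unitInterval, e.σ ω {({ω} : Message)} = 1) : G.payoff e = G.unravelingPayoff := by
  have := e.markov_σ
  refine integral_congr_ae ?_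
  filter_upwards [G.ae_eq_lowestAction] with ω hω
  have h1 : G.messagePayoff e {ω} = G.v (G.lowestAction ω) := by
    refine le_antisymm (G.messagePayoff_le fun i hi => ?_) (he.le_messagePayoff_singleton ω)
    rw [hω i (he.mem_A_of_singleton hi)]
  have h2 : ∀ᵐ m ∂(e.σ ω), G.messagePayoff e m = G.v (G.lowestAction ω) := by
    have : ∀ᵐ m ∂(e.σ ω), m ∈ ({({ω} : Message)} : Set Message) :=
      (mem_ae_iff_prob_eq_one (measurableSet_singleton _)).2 (hσ ω)
    filter_upwards [this] with m hm
    rw [mem_singleton_iff.1 hm, h1]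
  rw [integral_congr_ae h2]
  simp

theorem exists_isGreatest_support (e : Assessment n) (m : Message) :
    ∃ i, IsGreatest {i | 0 < e.τ m {i}} i := by
  have hne : {i : Fin n | 0 < e.τ m {i}}.Nonempty := by
    by_contra h
    have h0 : ∀ i, (e.τ m).real {i} = 0 := fun i => by
      have : ¬ 0 < e.τ m {i} := fun hi => h ⟨i, hi⟩
      simp [measureReal_def, nonpos_iff_eq_zero.1 (not_lt.1 this)]
    have := sum_real_singleton e m
    simp [h0] at this
  obtain ⟨i, hi, hmax⟩ := WellFounded.has_min (wellFounded_gt (α := Fin n)) _ hne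
  exact ⟨i, hi, fun j hj => not_lt.1 (hmax j hj)⟩

/-- The highest action that Receiver may take after a message. -/
noncomputable def topAction (e : Assessment n) (m : Message) : Fin n :=
  (exists_isGreatest_support e m).choose

theorem topAction_spec (e : Assessment n) (m : Message) :
    IsGreatest {i | 0 < e.τ m {i}} (topAction e m) :=
  (exists_isGreatest_support e m).choose_spec

theorem measurable_topAction (e : Assessment n) : Measurable (topAction e) := by
  have hS : ∀ i : Fin n, MeasurableSet {m | 0 < e.τ m {i}} := fun i =>
    (Kernel.measurable_coe e.τ (measurableSet_singleton i)) measurableSet_Ioi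
  refine measurable_to_countable' fun i => ?_
  have : topAction e ⁻¹' {i} = {m | 0 < e.τ m {i}} \ ⋃ j > i, {m | 0 < e.τ m {j}} := by
    ext m
    have hm := topAction_spec e m
    rw [mem_preimage, mem_singleton_iff]
    constructor
    · rintro rfl
      refine ⟨hm.1, fun h => ?_⟩
      obtain ⟨j, hj, hjm⟩ := mem_iUnion₂.1 h
      exact (hm.2 hjm).not_gt hj
    · rintro ⟨h1, h2⟩
      refine le_antisymm (not_lt.1 fun hlt => h2 (mem_iUnion₂.2 ⟨_, hlt, hm.1⟩)) (hm.2 h1)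
  rw [this]
  exact (hS i).diff (MeasurableSet.iUnion fun j => MeasurableSet.iUnion fun _ => hS j)

/-- An equilibrium induces a fractional partition of the states according to the highest action
that Receiver may take; its cells satisfy Receiver's incentive constraints, and it gives Sender at
least her equilibrium payoff. -/
theorem IsEquilibrium.exists_isFractionalPartition (he : G.IsEquilibrium e) :
    ∃ β, IsFractionalPartition G.prior G.upperCutoff β ∧
      (∀ i, G.γ i.castSucc * ∫ x, β i x ∂G.prior ≤ ∫ x, (x : ℝ) * β i x ∂G.prior) ∧
      G.payoff e ≤ ∑ i, G.v i * ∫ x, β i x ∂G.prior := by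
  have := e.markov_σ
  have := e.markov_p
  have hT : ∀ i, MeasurableSet {m | topAction e m = i} := fun i =>
    measurable_topAction e (measurableSet_singleton i)
  set β : Fin n → unitInterval → ℝ := fun i ω => (e.σ ω).real {m | topAction e m = i} with hβ
  have hF : IsFractionalPartition G.prior G.upperCutoff β := by
    refine ⟨fun i => (Kernel.measurable_coe e.σ (hT i)).ennreal_toReal,
      fun i x => measureReal_nonneg, ae_of_all _ fun x => ?_, fun i => ae_of_all _ fun x hx => ?_⟩
    · have := integral_comp_fin (μ := e.σ x) (measurable_topAction e) (fun _ => (1 : ℝ))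
      simpa using this.symm
    -- A state above the upper cutoff of `i` gains by revealing itself, since even its lowest
    -- optimal action beats `i`.
    · have hae : ∀ᵐ m ∂(e.σ x), topAction e m ≠ i := by
        filter_upwards [he.sender_optimal x] with m hm hmi
        have h1 := hm.2 {x} (by simp [← SetLike.mem_coe])
        have h2 : G.messagePayoff e m ≤ G.v i := G.messagePayoff_le fun j hj =>
          G.v_strictMono.monotone (hmi ▸ (topAction_spec e m).2 hj)
        have h3 := he.le_messagePayoff_singleton x
        have h4 : i < G.lowestAction x := by
          by_contra hle
          exact ((G.le_upperCutoff_lowestAction x).trans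
            (G.upperCutoff_mono (not_lt.1 hle))).not_gt hx
        have h5 := G.v_strictMono h4
        linarith
      have : e.σ x {m | topAction e m = i} = 0 := by
        simpa [ae_iff] using hae
      simp [hβ, measureReal_def, this]
  refine ⟨β, hF, fun i => ?_, ?_⟩
  -- The joint law of state and message is integrated in both orders. State first, `F` gives moment
  -- minus `γ_i` times mass; message first, Receiver's optimality makes each conditional integral
  -- nonnegative. Bayes' rule equates the two.
  · set F : unitInterval × Message → ℝ := fun q =>
      ((q.1 : ℝ) - G.γ i.castSucc) * {m | topAction e m = i}.indicator 1 q.2 with hFdef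
    have hFm : Measurable F := by
      refine Measurable.mul ?_ ((measurable_one.indicator (hT i)).comp measurable_snd)
      exact (measurable_subtype_coe.comp measurable_fst).sub_const _
    have hFb : ∀ q, ‖F q‖ ≤ 1 + |G.γ i.castSucc| := fun q => by
      rw [hFdef, norm_mul]
      have h1 : ‖({m | topAction e m = i}.indicator 1 q.2 : ℝ)‖ ≤ 1 := by
        by_cases h : topAction e q.2 = i <;> simp [h]
      have h2 : ‖(q.1 : ℝ) - G.γ i.castSucc‖ ≤ 1 + |G.γ i.castSucc| := by
        refine (norm_sub_le _ _).trans ?_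
        have := abs_coe_unitInterval_le_one q.1
        simp only [Real.norm_eq_abs]
        linarith
      calc _ ≤ (1 + |G.γ i.castSucc|) * 1 := by gcongr
        _ = _ := mul_one _
    have hI1 : Integrable F (G.prior ⊗ₘ e.σ) :=
      Integrable.of_bound hFm.aestronglyMeasurable _ (ae_of_all _ hFb)
    have hI2 : Integrable (fun q => F q.swap) ((e.σ ∘ₘ G.prior) ⊗ₘ e.p) :=
      Integrable.of_bound (hFm.comp measurable_swap).aestronglyMeasurable _
        (ae_of_all _ fun q => hFb q.swap)
    have hleft : ∫ q, F q ∂(G.prior ⊗ₘ e.σ) =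
        ∫ x, (x : ℝ) * β i x ∂G.prior - G.γ i.castSucc * ∫ x, β i x ∂G.prior := by
      rw [Measure.integral_compProd hI1, ← integral_const_mul,
        ← integral_sub (hF.integrable i).coe_mul ((hF.integrable i).const_mul _)]
      congr 1; ext x
      simp only [hFdef]
      rw [integral_const_mul, integral_indicator_one (hT i)]
      ring
    have hright : 0 ≤ ∫ q, F q.swap ∂((e.σ ∘ₘ G.prior) ⊗ₘ e.p) := by
      rw [Measure.integral_compProd hI2]
      refine integral_nonneg fun m => ?_
      simp only [hFdef, Prod.fst_swap, Prod.snd_swap, Pi.zero_apply]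
      rw [integral_mul_const]
      by_cases h : topAction e m = i
      · have hm := he.receiver_optimal m i (h ▸ (topAction_spec e m).1)
        have hx1 : Integrable (fun x : unitInterval => (x : ℝ)) (e.p m) := by
          simpa using (integrable_const (1 : ℝ)).coe_mul (μ := e.p m)
        rw [integral_sub hx1 (integrable_const _)]
        refine mul_nonneg ?_ (indicator_nonneg (fun _ _ => zero_le_one) _)
        have := hm.1
        simp
        linarith
      · simp [h]
    rw [he.bayes, integral_map (f := fun q => F q.swap) measurable_swap.aemeasurable
      (hFm.comp measurable_swap).aestronglyMeasurable] at hright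
    simp only [Prod.swap_swap] at hright
    linarith
  · have h : ∀ ω, ∫ m, G.messagePayoff e m ∂(e.σ ω) ≤ ∑ i, G.v i * β i ω := fun ω => by
      rw [← integral_comp_fin (measurable_topAction e) G.v]
      exact integral_mono (G.integrable_messagePayoff e ω)
        (integrable_comp_fin (measurable_topAction e) G.v) fun m => G.messagePayoff_le fun j hj =>
          G.v_strictMono.monotone ((topAction_spec e m).2 hj)
    have hint : ∀ i, Integrable (fun ω => G.v i * β i ω) G.prior := fun i =>
      (hF.integrable i).const_mul _
    refine (integral_mono (G.integrable_integral_messagePayoff e)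
      (integrable_finsetSum _ fun i _ => hint i) h).trans (le_of_eq ?_)
    rw [integral_finsetSum _ fun i _ => hint i]
    simp_rw [integral_const_mul]

end DisclosureGame

/-! ### Pure assessments and the unraveling equilibrium -/

namespace DisclosureGame

variable {n : ℕ} (G : DisclosureGame n)

/-- The assessment in which Sender and Receiver play pure strategies. -/
noncomputable def pureAssessment (s : unitInterval → Message) (hs : Measurable s)
    (hmem : ∀ ω, ω ∈ s ω) (t : Message → Fin n) (ht : Measurable t)
    (p : Kernel Message unitInterval) (hp : IsMarkovKernel p) : Assessment n where
  σ := Kernel.deterministic s hs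
  markov_σ := inferInstance
  σ_verifiable ω := by
    have hS : MeasurableSet {m : Message | ω ∈ m} := by
      have : {m : Message | ω ∈ m} = {m : Message | ((m : Set unitInterval) ∩ {ω}).Nonempty} := by
        ext m; simp [inter_singleton_nonempty]
      rw [this]
      exact (TopologicalSpace.NonemptyCompacts.isClosed_inter_nonempty_of_isClosed
        isClosed_singleton).measurableSet
    rw [Kernel.deterministic_apply]
    exact (ae_dirac_iff hS).2 (hmem ω)
  τ := Kernel.deterministic t ht
  markov_τ := inferInstance
  p := p
  markov_p := hp

section PureAssessment

variable {s : unitInterval → Message} {hs : Measurable s} {hmem : ∀ ω, ω ∈ s ω}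
  {t : Message → Fin n} {ht : Measurable t} {p : Kernel Message unitInterval}
  {hp : IsMarkovKernel p}

theorem messagePayoff_pureAssessment (m : Message) :
    G.messagePayoff (pureAssessment s hs hmem t ht p hp) m = G.v (t m) := by
  have h : ∀ i, 0 < (pureAssessment s hs hmem t ht p hp).τ m {i} → i = t m := fun i hi => by
    by_contra hne
    rw [pureAssessment, Kernel.deterministic_apply' _ _ (measurableSet_singleton i),
      indicator_of_notMem (fun h => hne h.symm)] at hi
    exact lt_irrefl _ hi
  exact le_antisymm (G.messagePayoff_le fun i hi => (congrArg G.v (h i hi)).le)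
    (G.le_messagePayoff fun i hi => (congrArg G.v (h i hi)).ge)

theorem payoff_pureAssessment :
    G.payoff (pureAssessment s hs hmem t ht p hp) = ∫ ω, G.v (t (s ω)) ∂G.prior := by
  refine integral_congr_ae (ae_of_all _ fun ω => ?_)
  simp only [messagePayoff_pureAssessment]
  exact integral_dirac _ _

variable {G}

theorem isEquilibrium_pureAssessment
    (hopt : ∀ ω, ∀ m : Message, ω ∈ m → t m ≤ t (s ω))
    (hrec : ∀ m, ∫ x, (x : ℝ) ∂(p m) ∈ G.A (t m)) (hbel : ∀ m : Message, ∀ᵐ x ∂(p m), x ∈ m)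
    (hbayes : G.prior.map s ⊗ₘ p = G.prior.map fun ω => (s ω, ω)) :
    G.IsEquilibrium (pureAssessment s hs hmem t ht p hp) where
  sender_optimal ω := by
    have hm : ∀ᵐ m ∂((pureAssessment s hs hmem t ht p hp).σ ω), m = s ω := by
      change ∀ᵐ m ∂(Kernel.deterministic s hs ω), m = s ω
      rw [Kernel.deterministic_apply]
      exact (ae_dirac_iff (measurableSet_singleton _)).2 rfl
    filter_upwards [hm] with m hm
    rw [hm]
    refine ⟨hmem ω, fun m' hm' => ?_⟩
    rw [messagePayoff_pureAssessment, messagePayoff_pureAssessment]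
    exact G.v_strictMono.monotone (hopt ω m' hm')
  receiver_optimal m i hi := by
    have : i = t m := by
      by_contra hne
      rw [pureAssessment, Kernel.deterministic_apply' _ _ (measurableSet_singleton i),
        indicator_of_notMem (fun h => hne h.symm)] at hi
      exact lt_irrefl _ hi
    rw [this]
    exact hrec m
  belief_verifiable := hbel
  bayes := by
    change (Kernel.deterministic s hs ∘ₘ G.prior) ⊗ₘ p =
      (G.prior ⊗ₘ Kernel.deterministic s hs).map Prod.swap
    rw [Measure.deterministic_comp_eq_map, Measure.compProd_deterministic,
      Measure.map_map measurable_swap (measurable_id'.prodMk hs), hbayes]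
    rfl

end PureAssessment

theorem measurable_singleton_message : Measurable fun ω : unitInterval => ({ω} : Message) :=
  TopologicalSpace.NonemptyCompacts.continuous_singleton.measurable

/-- Skeptical beliefs deter pooling: any message is attributed to its lowest state, so it induces no
higher action than full revelation of a state that it contains. -/
theorem exists_isEquilibrium_unraveling :
    ∃ e : Assessment n, G.IsEquilibrium e ∧ ∀ ω : unitInterval, e.σ ω {({ω} : Message)} = 1 := by
  refine ⟨pureAssessment (fun ω => {ω}) measurable_singleton_message
    (fun ω => by simp [← SetLike.mem_coe]) (fun m => G.lowestAction (minState m))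
    (G.measurable_lowestAction.comp measurable_minState)
    (Kernel.deterministic minState measurable_minState) inferInstance,
    isEquilibrium_pureAssessment (fun ω m hm => ?_) (fun m => ?_) (fun m => ?_) ?_, fun ω => ?_⟩
  · rw [minState_singleton]
    exact G.lowestAction_mono (minState_le hm)
  · rw [Kernel.deterministic_apply, integral_dirac]
    exact G.coe_mem_A_lowestAction _
  · rw [Kernel.deterministic_apply]
    exact (ae_dirac_iff m.isCompact.measurableSet).2 (minState_mem m)
  · rw [Measure.compProd_deterministic, Measure.map_map
      (measurable_id'.prodMk measurable_minState) measurable_singleton_message]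
    congr 1; ext ω : 1
    simp [minState_singleton]
  · change Kernel.deterministic _ measurable_singleton_message ω _ = 1
    rw [Kernel.deterministic_apply' _ _ (measurableSet_singleton _)]
    simp

/-! ### Recommendation equilibria from deterministic representations -/

section Recommendation

variable {G} {B : Fin n → Set unitInterval}

theorem IsDeterministicRepresentation.exists_isGreatest (hB : G.IsDeterministicRepresentation B)
    (ω : unitInterval) : ∃ i, IsGreatest {i | ω ∈ B i} i := by
  have hne : {i : Fin n | ω ∈ B i}.Nonempty := mem_iUnion.1 (hB.cover ▸ mem_univ ω)
  obtain ⟨i, hi, hmax⟩ := WellFounded.has_min (wellFounded_gt (α := Fin n)) _ hne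
  exact ⟨i, hi, fun j hj => not_lt.1 (hmax j hj)⟩

/-- The action that is recommended in a state: the highest `i` such that `B i` has the state. -/
noncomputable def IsDeterministicRepresentation.recommendation
    (hB : G.IsDeterministicRepresentation B) (ω : unitInterval) : Fin n :=
  (hB.exists_isGreatest ω).choose

theorem IsDeterministicRepresentation.recommendation_spec
    (hB : G.IsDeterministicRepresentation B) (ω : unitInterval) :
    IsGreatest {i | ω ∈ B i} (hB.recommendation ω) :=
  (hB.exists_isGreatest ω).choose_spec

theorem IsDeterministicRepresentation.recommendation_eq_iff
    (hB : G.IsDeterministicRepresentation B) {ω : unitInterval} {i : Fin n} :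
    hB.recommendation ω = i ↔ ω ∈ B i \ ⋃ j > i, B j := by
  have h := hB.recommendation_spec ω
  constructor
  · rintro rfl
    refine ⟨h.1, fun hu => ?_⟩
    obtain ⟨j, hj, hωj⟩ := mem_iUnion₂.1 hu
    exact (h.2 hωj).not_gt hj
  · rintro ⟨h1, h2⟩
    exact le_antisymm (not_lt.1 fun hlt => h2 (mem_iUnion₂.2 ⟨_, hlt, h.1⟩)) (h.2 h1)

theorem IsDeterministicRepresentation.measurable_recommendation
    (hB : G.IsDeterministicRepresentation B) : Measurable hB.recommendation := by
  refine measurable_to_countable' fun i => ?_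
  have : hB.recommendation ⁻¹' {i} = B i \ ⋃ j > i, B j := by
    ext ω; exact hB.recommendation_eq_iff
  rw [this]
  exact (hB.isClosed i).measurableSet.diff (MeasurableSet.iUnion fun j =>
    MeasurableSet.iUnion fun _ => (hB.isClosed j).measurableSet)

theorem IsDeterministicRepresentation.recommendation_ae_eq
    (hB : G.IsDeterministicRepresentation B) (i : Fin n) :
    {ω | hB.recommendation ω = i} =ᵐ[G.prior] B i := by
  have hsub : {ω | hB.recommendation ω = i} ⊆ B i := fun ω hω => (hB.recommendation_eq_iff.1 hω).1
  refine hsub.eventuallyLE.antisymm ?_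
  rw [ae_le_set]
  refine measure_mono_null (t := ⋃ j, ⋃ (_ : i ≠ j), B i ∩ B j) ?_ ?_
  · rintro ω ⟨h1, h2⟩
    exact mem_iUnion₂.2 ⟨hB.recommendation ω, fun h => h2 h.symm, h1, (hB.recommendation_spec ω).1⟩
  · exact measure_iUnion_null fun j => measure_iUnion_null fun hij => hB.null_inter i j hij

/-- A deterministic representation whose cells satisfy the incentive constraints of Sender and of
Receiver is associated with an obedient recommendation equilibrium. -/
theorem IsDeterministicRepresentation.exists_isORE (hB : G.IsDeterministicRepresentation B)
    (hcut : ∀ i, ∀ ω ∈ B i, ω ≤ G.upperCutoff i)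
    (hpos : ∀ i, (B i).Nonempty → G.prior (B i) ≠ 0)
    (hmean : ∀ i, G.γ i.castSucc * G.prior.real (B i) ≤ ∫ x in B i, (x : ℝ) ∂G.prior) :
    ∃ e, G.IsORE e B ∧ G.payoff e = ∑ i, G.v i * G.prior.real (B i) := by
  classical
  set N : Set Message := {m | ∃ i, (m : Set unitInterval) = B i} with hN
  have huniq : ∀ (m : Message) (i j : Fin n), (m : Set unitInterval) = B i →
      (m : Set unitInterval) = B j → i = j := fun m i j hi hj => by
    -- Two equal cells would coincide with their null intersection, contrary to `hpos`; so a message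
    -- recommends only one action.
    by_contra hne
    have h0 := hB.null_inter i j hne
    rw [← hi, ← hj, inter_self, hi] at h0
    exact hpos i (hi ▸ m.nonempty) h0
  have hNfin : N.Finite := by
    have : N ⊆ ⋃ i, {m : Message | (m : Set unitInterval) = B i} := fun m ⟨i, hi⟩ =>
      mem_iUnion.2 ⟨i, hi⟩
    refine (finite_iUnion fun i => Set.Subsingleton.finite ?_).subset this
    exact fun m hm m' hm' => SetLike.coe_injective (hm.trans hm'.symm)
  -- Cells are obeyed; any other message meets skepticism. The finitely many exceptions do not
  -- affect measurability, here or for the beliefs `P`.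
  set t : Message → Fin n := fun m => if h : ∃ i, (m : Set unitInterval) = B i then h.choose else
    G.lowestAction (minState m) with ht
  have ht1 : ∀ (m : Message) (i : Fin n), (m : Set unitInterval) = B i → t m = i := fun m i hi => by
    have h : ∃ i, (m : Set unitInterval) = B i := ⟨i, hi⟩
    simp only [ht, dif_pos h]
    exact huniq m _ _ h.choose_spec hi
  have ht2 : ∀ m : Message, m ∉ N → t m = G.lowestAction (minState m) := fun m hm => dif_neg hm
  have htm : Measurable t := by
    refine (G.measurable_lowestAction.comp measurable_minState).measurable_of_countable_ne
      (hNfin.subset fun m hm => ?_).countable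
    by_contra hmN
    exact hm (ht2 m hmN).symm
  set P : Message → Measure unitInterval := fun m =>
    if m ∈ N then cond G.prior (m : Set unitInterval) else Measure.dirac (minState m) with hP
  have hPm : Measurable P := by
    refine (Measure.measurable_dirac.comp measurable_minState).measurable_of_countable_ne
      (hNfin.subset fun m hm => ?_).countable
    by_contra hmN
    exact hm (by simp [hP, hmN])
  set p : Kernel Message unitInterval := ⟨P, hPm⟩ with hp
  have hp1 : ∀ (m : Message) (i : Fin n), (m : Set unitInterval) = B i →
      p m = cond G.prior (B i) := fun m i hi => by
    rw [← hi]; exact if_pos ⟨i, hi⟩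
  have hp2 : ∀ m : Message, m ∉ N → p m = Measure.dirac (minState m) := fun m hm => if_neg hm
  have hpM : IsMarkovKernel p := ⟨fun m => by
    by_cases hm : m ∈ N
    · obtain ⟨i, hi⟩ := hm
      rw [hp1 m i hi]
      exact cond_isProbabilityMeasure (hpos i (hi ▸ m.nonempty))
    · rw [hp2 m hm]; infer_instance⟩
  -- The default `{0}` stands for an empty cell, which is never recommended.
  set msg : Fin n → Message := fun i => if h : (B i).Nonempty then
    ⟨⟨B i, (hB.isClosed i).isCompact⟩, h⟩ else {0} with hmsg
  have hmsg1 : ∀ i, (B i).Nonempty → (msg i : Set unitInterval) = B i := fun i hi => by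
    simp only [hmsg, dif_pos hi]; rfl
  have hne : ∀ ω, (B (hB.recommendation ω)).Nonempty := fun ω => ⟨ω, (hB.recommendation_spec ω).1⟩
  set s : unitInterval → Message := fun ω => msg (hB.recommendation ω) with hs
  have hsm : Measurable s := (measurable_of_countable msg).comp hB.measurable_recommendation
  have hsB : ∀ ω, (s ω : Set unitInterval) = B (hB.recommendation ω) := fun ω => hmsg1 _ (hne ω)
  have hmem : ∀ ω, ω ∈ s ω := fun ω => by
    rw [← SetLike.mem_coe, hsB]; exact (hB.recommendation_spec ω).1
  have hts : ∀ ω, t (s ω) = hB.recommendation ω := fun ω => ht1 _ _ (hsB ω)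
  have hBm : ∀ i, MeasurableSet (B i) := fun i => (hB.isClosed i).measurableSet
  have hmap : ∀ (T : Set unitInterval) (i : Fin n),
      (G.prior.restrict T).map hB.recommendation {i} = G.prior (B i ∩ T) := fun T i => by
    rw [Measure.map_apply hB.measurable_recommendation (measurableSet_singleton i),
      Measure.restrict_apply (hB.measurable_recommendation (measurableSet_singleton i))]
    exact measure_congr ((hB.recommendation_ae_eq i).inter ae_eq_rfl)
  have heq : G.IsEquilibrium (pureAssessment s hsm hmem t htm p hpM) := by
    refine isEquilibrium_pureAssessment (fun ω m hm => ?_) (fun m => ?_) (fun m => ?_) ?_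
    -- Among the cells that contain `ω`, the recommended one has the highest index. Any other
    -- message yields at most `lowestAction ω`, which `hcut` bounds by the recommendation.
    · rw [hts]
      by_cases hmN : m ∈ N
      · obtain ⟨i, hi⟩ := hmN
        rw [ht1 m i hi]
        refine (hB.recommendation_spec ω).2 ?_
        rw [← SetLike.mem_coe, hi] at hm
        exact hm
      · rw [ht2 m hmN]
        exact G.lowestAction_le ((minState_le hm).trans
          (hcut _ ω (hB.recommendation_spec ω).1))
    · by_cases hmN : m ∈ N
      · obtain ⟨i, hi⟩ := hmN
        have h0 : 0 < G.prior.real (B i) :=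
          ENNReal.toReal_pos (hpos i (hi ▸ m.nonempty)) (measure_ne_top _ _)
        have hx1 : Integrable (fun x : unitInterval => (x : ℝ)) G.prior := by
          simpa using (integrable_const (1 : ℝ)).coe_mul (μ := G.prior)
        have hup : ∫ x in B i, (x : ℝ) ∂G.prior ≤ G.γ i.succ * G.prior.real (B i) := by
          have := setIntegral_mono_on hx1.integrableOn (integrable_const (G.γ i.succ)).integrableOn
            (hBm i) fun x hx => (hcut i x hx : (x : ℝ) ≤ G.γ i.succ)
          rw [setIntegral_const, smul_eq_mul, mul_comm] at this
          exact this
        rw [ht1 m i hi, hp1 m i hi, ProbabilityTheory.cond, integral_smul_measure, ENNReal.toReal_inv, smul_eq_mul,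
          ← measureReal_def, inv_mul_eq_div]
        exact ⟨(le_div_iff₀ h0).2 (hmean i), (div_le_iff₀ h0).2 hup⟩
      · rw [ht2 m hmN, hp2 m hmN, integral_dirac]
        exact G.coe_mem_A_lowestAction _
    · by_cases hmN : m ∈ N
      · obtain ⟨i, hi⟩ := hmN
        rw [hp1 m i hi]
        filter_upwards [ae_cond_mem (μ := G.prior) (hBm i)] with x hx
        rw [← SetLike.mem_coe, hi]
        exact hx
      · rw [hp2 m hmN]
        exact (ae_dirac_iff m.isCompact.measurableSet).2 (minState_mem m)
    · have := Measure.isProbabilityMeasure_map (μ := G.prior) hsm.aemeasurable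
      -- On rectangles both sides become finite sums over the recommendations, equal term by term by
      -- the definition of conditional probability.
      refine Measure.ext_prod fun {S T} hS hT => ?_
      rw [Measure.compProd_apply_prod hS hT, ← lintegral_indicator hS,
        lintegral_map ((Kernel.measurable_coe p hT).indicator hS) hsm,
        Measure.map_apply (hsm.prodMk measurable_id') (hS.prod hT)]
      have hpre : (fun ω => (s ω, ω)) ⁻¹' S ×ˢ T = s ⁻¹' S ∩ T := rfl
      have hleft : ∫⁻ ω, S.indicator (fun m => p m T) (s ω) ∂G.prior =
          ∑ i, S.indicator (fun m => p m T) (msg i) * G.prior (B i) := by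
        have := lintegral_map (μ := G.prior)
          (measurable_of_countable fun i => S.indicator (fun m => p m T) (msg i))
          hB.measurable_recommendation
        rw [← this, lintegral_fintype]
        refine Finset.sum_congr rfl fun i _ => ?_
        have := hmap univ i
        rw [Measure.restrict_univ, inter_univ] at this
        rw [this]
      have hright : G.prior (s ⁻¹' S ∩ T) = ∑ i, S.indicator 1 (msg i) * G.prior (B i ∩ T) := by
        have := lintegral_map (μ := G.prior.restrict T)
          (measurable_of_countable fun i => S.indicator (1 : Message → ℝ≥0∞) (msg i))
          hB.measurable_recommendation
        rw [← Measure.restrict_apply (hsm hS), ← lintegral_indicator_one (hsm hS)]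
        have h2 : ∫⁻ ω, (s ⁻¹' S).indicator 1 ω ∂(G.prior.restrict T) =
            ∫⁻ ω, S.indicator (1 : Message → ℝ≥0∞) (msg (hB.recommendation ω))
              ∂(G.prior.restrict T) := rfl
        rw [h2, ← this, lintegral_fintype]
        exact Finset.sum_congr rfl fun i _ => by rw [hmap]
      rw [hpre, hleft, hright]
      refine Finset.sum_congr rfl fun i _ => ?_
      by_cases hi : (B i).Nonempty
      · by_cases hiS : msg i ∈ S
        · rw [indicator_of_mem hiS, indicator_of_mem hiS, hp1 _ i (hmsg1 i hi), Pi.one_apply,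
            one_mul, cond_mul_eq_inter (hBm i)]
        · simp [hiS]
      · rw [not_nonempty_iff_eq_empty.1 hi]; simp
  refine ⟨pureAssessment s hsm hmem t htm p hpM, ⟨heq, hB, fun i ω hω => ?_, fun i m hm => ?_⟩, ?_⟩
  · refine ⟨msg i, hmsg1 i ⟨ω, hω.1⟩, ?_⟩
    change Kernel.deterministic s hsm ω {msg i} = 1
    rw [Kernel.deterministic_apply' _ _ (measurableSet_singleton _), indicator_of_mem]
    · exact congrArg msg (hB.recommendation_eq_iff.2 hω)
  · change Kernel.deterministic t htm m {i} = 1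
    rw [Kernel.deterministic_apply' _ _ (measurableSet_singleton _),
      indicator_of_mem (show t m ∈ ({i} : Set (Fin n)) from ht1 m i hm)]
  · rw [payoff_pureAssessment]
    simp_rw [hts]
    rw [integral_comp_fin hB.measurable_recommendation G.v]
    refine Finset.sum_congr rfl fun i _ => ?_
    rw [measureReal_congr (hB.recommendation_ae_eq i)]

end Recommendation

/-- The payoffs that fractional partitions satisfying the incentive constraints attain are
attained by obedient recommendation equilibria with a laminar representation. -/
theorem exists_isORE_isLaminar {β : Fin n → unitInterval → ℝ}
    (hβ : IsFractionalPartition G.prior G.upperCutoff β)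
    (hmean : ∀ i, G.γ i.castSucc * ∫ x, β i x ∂G.prior ≤ ∫ x, (x : ℝ) * β i x ∂G.prior) :
    ∃ (e : Assessment n) (B : Fin n → Set unitInterval), G.IsORE e B ∧ IsLaminar B ∧
      G.payoff e = ∑ i, G.v i * ∫ x, β i x ∂G.prior := by
  obtain ⟨a, b, hcell, hm0, hm1, hb, hz⟩ := hβ.exists_carvedCell G.upperCutoff_mono
  have hreal : ∀ i, G.prior.real (closure (carvedCell a b i)) = ∫ x, β i x ∂G.prior := fun i => by
    rw [measureReal_congr (closure_carvedCell_ae_eq i), ← hm0, setIntegral_const, smul_eq_mul,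
      mul_one]
  have hB : G.IsDeterministicRepresentation fun i => closure (carvedCell a b i) :=
    ⟨fun i => isClosed_closure, iUnion_closure_carvedCell hcell.sum_eq_one,
      fun i j hij => measure_closure_carvedCell_inter hij⟩
  obtain ⟨e, he, hpay⟩ := hB.exists_isORE
    (fun i ω hω => (closure_carvedCell_subset a b i hω).2.trans (hb i))
    -- A null cell was given an empty interval, so a nonempty cell has positive mass.
    (fun i hne h0 => by
      obtain ⟨x, hx⟩ := hne
      have hx' := closure_carvedCell_subset a b i hx
      refine (hz i ?_).not_ge (hx'.1.trans hx'.2)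
      rw [← hreal, measureReal_def, h0, ENNReal.toReal_zero])
    (fun i => by
      rw [hreal, setIntegral_congr_set (closure_carvedCell_ae_eq i), hm1]
      exact hmean i)
  refine ⟨e, _, he, isLaminar_closure_carvedCell a b, ?_⟩
  simp_rw [hpay, hreal]

/-- The partition of the states by Receiver's lowest optimal action under full revelation. -/
theorem exists_isFractionalPartition_unraveling :
    ∃ β, IsFractionalPartition G.prior G.upperCutoff β ∧
      (∀ i, G.γ i.castSucc * ∫ x, β i x ∂G.prior ≤ ∫ x, (x : ℝ) * β i x ∂G.prior) ∧
      ∑ i, G.v i * ∫ x, β i x ∂G.prior = G.unravelingPayoff := by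
  have hm : ∀ i, MeasurableSet {x | G.lowestAction x = i} := fun i =>
    G.measurable_lowestAction (measurableSet_singleton i)
  have hF : IsFractionalPartition G.prior G.upperCutoff
      fun i => {x | G.lowestAction x = i}.indicator 1 := by
    refine ⟨fun i => measurable_one.indicator (hm i),
      fun i => indicator_nonneg fun _ _ => zero_le_one, ae_of_all _ fun x => ?_,
      fun i => ae_of_all _ fun x hx => ?_⟩
    · rw [Finset.sum_eq_single (G.lowestAction x)]
      · simp
      · intro i _ hi
        have hn : x ∉ {x | G.lowestAction x = i} := fun h => hi h.symm
        rw [indicator_of_notMem hn]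
      · simp
    · have hn : x ∉ {x | G.lowestAction x = i} := fun h =>
        (show x ≤ G.upperCutoff i from h ▸ G.le_upperCutoff_lowestAction x).not_gt hx
      rw [indicator_of_notMem hn]
  refine ⟨_, hF, fun i => ?_, ?_⟩
  · rw [← integral_const_mul]
    refine integral_mono ((hF.integrable i).const_mul _) (hF.integrable i).coe_mul fun x => ?_
    by_cases h : G.lowestAction x = i
    · have := (G.coe_mem_A_lowestAction x).1
      rw [h] at this
      simpa [h] using this
    · simp [h]
  · rw [unravelingPayoff, integral_comp_fin G.measurable_lowestAction G.v]
    exact Finset.sum_congr rfl fun i _ => by rw [integral_indicator_one (hm i)]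

end DisclosureGame

/-! ### The interval of payoffs -/

theorem proposition5 {n : ℕ} (G : DisclosureGame n) :
    ∃ RU RS : ℝ,
      G.unravelingPayoffs = {RU} ∧
      IsGreatest G.equilibriumPayoffs RS ∧
      (∀ R : ℝ,
        (∃ (e : Assessment n) (B : Fin n → Set unitInterval), G.IsORE e B ∧ G.payoff e = R) ↔
          RU ≤ R ∧ R ≤ RS) ∧
      (∀ R : ℝ, RU ≤ R → R ≤ RS →
        ∃ (e : Assessment n) (B : Fin n → Set unitInterval),
          G.IsORE e B ∧ IsLaminar B ∧ G.payoff e = R) := by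
  obtain ⟨βU, hU, hUmean, hUpay⟩ := G.exists_isFractionalPartition_unraveling
  obtain ⟨RS, ⟨βS, hS, hSmean, hSpay⟩, hmax⟩ :=
    hU.exists_isGreatest G.upperCutoff_mono (fun i => G.γ i.castSucc) G.v hUmean
  have hupper : ∀ e, G.IsEquilibrium e → G.payoff e ≤ RS := fun e he => by
    obtain ⟨β, hβ, hmean, hle⟩ := he.exists_isFractionalPartition
    exact hle.trans (hmax ⟨β, hβ, hmean, rfl⟩)
  have hlam : ∀ R : ℝ, G.unravelingPayoff ≤ R → R ≤ RS →
      ∃ (e : Assessment n) (B : Fin n → Set unitInterval),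
        G.IsORE e B ∧ IsLaminar B ∧ G.payoff e = R := fun R h1 h2 => by
    -- The unraveling partition and an optimal one are mixed with the weights that express `R`;
    -- masses and moments are linear in the partition.
    obtain ⟨s, t, hs, ht, hst, hR⟩ : R ∈ segment ℝ G.unravelingPayoff RS := by
      rw [segment_eq_Icc (h1.trans h2)]; exact ⟨h1, h2⟩
    have hi0 : ∀ i, ∫ x, (s * βU i x + t * βS i x) ∂G.prior =
        s * ∫ x, βU i x ∂G.prior + t * ∫ x, βS i x ∂G.prior := fun i => by
      rw [integral_add ((hU.integrable i).const_mul s) ((hS.integrable i).const_mul t),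
        integral_const_mul, integral_const_mul]
    have hi1 : ∀ i, ∫ x, (x : ℝ) * (s * βU i x + t * βS i x) ∂G.prior =
        s * ∫ x, (x : ℝ) * βU i x ∂G.prior + t * ∫ x, (x : ℝ) * βS i x ∂G.prior := fun i => by
      rw [← integral_const_mul, ← integral_const_mul, ← integral_add
        ((hU.integrable i).coe_mul.const_mul s) ((hS.integrable i).coe_mul.const_mul t)]
      congr 1; ext x; ring
    obtain ⟨e, B, hORE, hL, hpay⟩ := G.exists_isORE_isLaminar (hU.convexCombination hS hs ht hst)
      (fun i => by
        rw [hi0, hi1]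
        have e1 := mul_le_mul_of_nonneg_left (hUmean i) hs
        have e2 := mul_le_mul_of_nonneg_left (hSmean i) ht
        linarith)
    refine ⟨e, B, hORE, hL, ?_⟩
    rw [hpay, ← hR, ← hUpay, ← hSpay]
    simp_rw [hi0, smul_eq_mul, Finset.mul_sum]
    rw [← Finset.sum_add_distrib]
    exact Finset.sum_congr rfl fun i _ => by ring
  have hle : G.unravelingPayoff ≤ RS := by
    rw [← hUpay]
    exact hmax ⟨βU, hU, hUmean, rfl⟩
  refine ⟨G.unravelingPayoff, RS, ?_, ⟨?_, ?_⟩, fun R => ⟨?_, ?_⟩, hlam⟩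
  · obtain ⟨e, he, hσ⟩ := G.exists_isEquilibrium_unraveling
    refine Subset.antisymm ?_ (singleton_subset_iff.2
      ⟨e, he, hσ, he.payoff_eq_unravelingPayoff hσ⟩)
    rintro _ ⟨e, he, hσ, rfl⟩
    exact he.payoff_eq_unravelingPayoff hσ
  · obtain ⟨e, B, hORE, -, hpay⟩ := hlam RS hle le_rfl
    exact ⟨e, hORE.isEquilibrium, hpay⟩
  · rintro _ ⟨e, he, rfl⟩
    exact hupper e he
  · rintro ⟨e, B, hORE, rfl⟩
    exact ⟨hORE.isEquilibrium.unravelingPayoff_le, hupper e hORE.isEquilibrium⟩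
  · rintro ⟨h1, h2⟩
    obtain ⟨e, B, hORE, -, hpay⟩ := hlam R h1 h2
    exact ⟨e, B, hORE, hpay⟩
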